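/- Let $\Bbbk$ be a field, let $n\ge 3$, and let $C_n$ be the cycle on the vertices $x_1,\dots,x_n$. Let $\mathcal C$ be any maximal (with respect to inclusion) independent set of $C_n$, and let $G=C_n(\mathcal C)$ be the $\mathcal C$-suspension of $C_n$, i.e. the graph obtained from $C_n$ by adjoining one new vertex $z$ and joining $z$ to every vertex of $\mathcal C$ and to no other vertex. Let $R=\Bbbk[x_1,\dots,x_n]$ and $S=R[z]$ with the standard grading, and let $I(C_n)\subseteq R$ and $I(G)\subseteq S$ be the edge ideals, generated by the products of the two variables of each edge, so that $I(G)=I(C_n)S+(zx_i : x_i\in\mathcal C)$. For a finitely generated graded module $M$ over one of these polynomial rings, with graded Betti numbers $\beta_{i,j}(M)=\dim_{\Bbbk}\operatorname{Tor}_i(\Bbbk,M)_j$, put $\operatorname{reg} M=\max\{j-i : \beta_{i,j}(M)\ne 0\}$ and $\operatorname{pdim} M=\max\{i : \beta_{i,j}(M)\neq 0\text{ for some }j\}$. Then (a) $\operatorname{reg} S/I(G)=\operatorname{reg} R/I(C_n)$; (b) $\operatorname{pdim} S/I(G)=\operatorname{pdim} R/I(C_n)+1$. -/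

import Mathlib

open MvPolynomial

/-- The `C`-suspension `G(C)` of a graph `G`: adjoin a new vertex `z = ⊤` to the vertex set and join
it to every vertex of `C` and to no other vertex. -/
def suspension {V : Type*} (G : SimpleGraph V) (C : Set V) : SimpleGraph (WithTop V) where
  Adj a b :=
    (∃ u v : V, a = u ∧ b = v ∧ G.Adj u v) ∨
    (∃ u ∈ C, a = ⊤ ∧ b = u) ∨
    (∃ u ∈ C, a = u ∧ b = ⊤)
  symm := ⟨by
    rintro a b (⟨u, v, ha, hb, h⟩ | ⟨u, hu, ha, hb⟩ | ⟨u, hu, ha, hb⟩)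
    · exact Or.inl ⟨v, u, hb, ha, h.symm⟩
    · exact Or.inr (Or.inr ⟨u, hu, hb, ha⟩)
    · exact Or.inr (Or.inl ⟨u, hu, hb, ha⟩)⟩
  loopless := ⟨by
    rintro a (⟨u, v, ha, hb, h⟩ | ⟨u, hu, ha, hb⟩ | ⟨u, hu, ha, hb⟩)
    · exact h.ne (WithTop.coe_injective (ha.symm.trans hb))
    · exact WithTop.coe_ne_top (hb.symm.trans ha)
    · exact WithTop.coe_ne_top (ha.symm.trans hb)⟩

/-- The edge ideal `I(G) = (x_u x_v : {u, v} an edge of G)` in the polynomial ring over `k` with one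
variable for each vertex. -/
noncomputable def edgeIdeal (k : Type*) [Field k] {V : Type*} (G : SimpleGraph V) : Ideal (MvPolynomial V k) :=
  Ideal.span {p | ∃ u v : V, G.Adj u v ∧ p = X u * X v}

noncomputable section

variable {k : Type*} [Field k] {V : Type*}

/-- The degree `d` part of `R/I`, where `R = k[x_v : v ∈ V]` is standard graded: the classes of the
homogeneous polynomials of degree `d`. -/
def quotientDegree (I : Ideal (MvPolynomial V k)) (d : ℕ) :
    Submodule k (MvPolynomial V k ⧸ I) :=
  (homogeneousSubmodule V k d).map (Ideal.Quotient.mkₐ k I).toLinearMap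

variable [Fintype V] [LinearOrder V]

/-- The differential of the Koszul complex `K(x; R/I) = K(x; R) ⊗ R/I` of the variables. The family
`c : Finset V → R/I` stands for the chain `∑ S, c S • e_S`, where
`e_S = e_{s₁} ∧ ⋯ ∧ e_{sᵢ}` for `S = {s₁ < ⋯ < sᵢ}`, and
`∂ e_S = ∑ v ∈ S, (-1) ^ #{w ∈ S | w < v} • x_v • e_{S \ {v}}`. So the coefficient of `∂ c` at `e_T` is
the sum below, over all `v` not in `T`. -/
def koszulDifferential (I : Ideal (MvPolynomial V k)) :
    (Finset V → MvPolynomial V k ⧸ I) →ₗ[k] (Finset V → MvPolynomial V k ⧸ I) where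
  toFun c T := ∑ v ∈ Tᶜ,
    (-1) ^ (T.filter (· < v)).card * (Ideal.Quotient.mk I (X v) * c (insert v T))
  map_add' c c' := by
    funext T
    simp only [Pi.add_apply, mul_add, Finset.sum_add_distrib]
  map_smul' a c := by
    funext T
    simp only [Pi.smul_apply, mul_smul_comm, Finset.smul_sum, RingHom.id_apply]

/-- The part of the Koszul complex of `R/I` in homological degree `i` and internal degree `j`: as
`e_S` has degree `#S`, these are the chains supported on the `e_S` with `#S = i` and with
coefficients in `(R/I)_{j - i}` (which is `0` for `j < i`). -/
def koszulChains (I : Ideal (MvPolynomial V k)) (i j : ℕ) :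
    Submodule k (Finset V → MvPolynomial V k ⧸ I) :=
  Submodule.pi Set.univ fun S : Finset V =>
    if S.card = i ∧ i ≤ j then quotientDegree I (j - i) else ⊥

/-- The cycles in homological degree `i` and internal degree `j`. -/
def koszulCycles (I : Ideal (MvPolynomial V k)) (i j : ℕ) :
    Submodule k (Finset V → MvPolynomial V k ⧸ I) :=
  koszulChains I i j ⊓ LinearMap.ker (koszulDifferential I)

/-- The boundaries in homological degree `i` and internal degree `j`. -/
def koszulBoundaries (I : Ideal (MvPolynomial V k)) (i j : ℕ) :
    Submodule k (Finset V → MvPolynomial V k ⧸ I) :=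
  (koszulChains I (i + 1) j).map (koszulDifferential I)

/-- The graded Betti number `β_{i,j}(R/I) = dim_k Tor_i^R(k, R/I)_j` of `R/I`, for a homogeneous ideal
`I` of `R = k[x_v : v ∈ V]`. The `Tor` is computed from the graded free resolution of `k` over `R` that
is given by the Koszul complex of the variables. -/
def gradedBetti (I : Ideal (MvPolynomial V k)) (i j : ℕ) : ℕ :=
  Module.finrank k
    (koszulCycles I i j ⧸ (koszulBoundaries I i j).comap (koszulCycles I i j).subtype)

/-- `reg (R/I) = r`: the number `r` is the maximum of `j - i` over all `i, j` with
`β_{i,j}(R/I) ≠ 0` (in particular the maximum exists). -/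
def IsRegularity (I : Ideal (MvPolynomial V k)) (r : ℤ) : Prop :=
  IsGreatest {m : ℤ | ∃ i j : ℕ, gradedBetti I i j ≠ 0 ∧ m = (j : ℤ) - (i : ℤ)} r

/-- `pdim (R/I) = p`: the number `p` is the maximum of the `i` such that `β_{i,j}(R/I) ≠ 0` for some
`j` (in particular the maximum exists). -/
def IsProjDim (I : Ideal (MvPolynomial V k)) (p : ℕ) : Prop :=
  IsGreatest {i : ℕ | ∃ j : ℕ, gradedBetti I i j ≠ 0} p

end

/-! By Hochster's formula (`gradedBetti_edgeIdeal_ne_zero_iff`), a Betti number of index `(i, j)` is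
nonzero exactly when some set `W` of `j` vertices induces a graph whose independence complex has
nonzero reduced cohomology at the faces with `j - i` vertices. So reg is the maximum of `s`, and
pdim the maximum of `|W| - s`, over the pairs `(W, s)` at which `IsGraphAcyclicAt` fails. These
pairs are controlled by the long exact sequence relating a complex to the link and the deletion of a
vertex.

For the suspension, deleting `z` leaves a subset of the cycle, while the link of `z` lives on a set
`U` disjoint from `C`. Each vertex of `U` has a neighbour in `C`, hence at most one in `U`; so if
`U` is not acyclic at `c`, it is a perfect matching with `c` edges (`card_eq_of_not`), each filling
a two-vertex gap of `C`. If `g` is the number of such gaps, then `n = 2|C| + g` and `c ≤ g ≤ |C|`.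

Regularity: the link could only contribute `s = c + 1`. The cycle attains this through separated
edges if `n ≥ 3c + 3`, and as a whole if `n = 3c + 2`. Otherwise `n = 3c` and all gaps have two
vertices; then one gap vertex and `z` can be deleted without killing the class
(`exists_not_isGraphAcyclicAt_of_gap`).

Projective dimension: a maximal independent set `F` forces pdim to be at least `|Fᶜ|`
(`exists_not_of_maximal_independent`). `C` is maximal independent in both graphs, with one more
vertex in its complement in the suspension. If the link of `z` matters, the value of `|W| - s` is at
most the bound so obtained; if not, adjoining or deleting `z` shifts `|W| - s` by one. -/

/-! ### Simplicial cochains: cones, links and deletions -/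

section Cochain

variable {k : Type*} [Field k] {V : Type*} [LinearOrder V]

/-- The simplicial coboundary of a cochain, a cochain being a function on finite sets. -/
def coboundary (f : Finset V → k) (F : Finset V) : k :=
  ∑ v ∈ F, (-1) ^ (F.filter (· < v)).card * f (F.erase v)

/-- The reduced simplicial cohomology, with coefficients in `k`, of the family `Γ` of faces vanishes
at the faces with `s` elements. -/
def IsAcyclicAt (k : Type*) [Field k] (Γ : Finset V → Prop) (s : ℕ) : Prop :=
  ∀ f : Finset V → k, (∀ F, Γ F → F.card = s + 1 → coboundary f F = 0) →
    ∃ g : Finset V → k, ∀ F, Γ F → F.card = s → coboundary g F = f F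

/-- The contraction of a cochain by the vertex `v`: a cochain on the link of `v`. -/
def contractVertex (v : V) (f : Finset V → k) (F : Finset V) : k :=
  (-1) ^ (F.filter (v < ·)).card * f (insert v F)

/-- The cochain that is `f₀` on the faces without `v`, and whose contraction by `v` is `f₁`. -/
def glueVertex (v : V) (f₀ f₁ : Finset V → k) (F : Finset V) : k :=
  if v ∈ F then (-1) ^ ((F.erase v).filter (v < ·)).card * f₁ (F.erase v) else f₀ F

lemma neg_one_pow_mul_self' (n : ℕ) : ((-1 : k) ^ n) * (-1) ^ n = 1 := by
  rw [← mul_pow]; simp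

lemma coboundary_congr {f g : Finset V → k} {F : Finset V}
    (h : ∀ v ∈ F, f (F.erase v) = g (F.erase v)) : coboundary f F = coboundary g F :=
  Finset.sum_congr rfl fun v hv => by rw [h v hv]

lemma coboundary_add (f g : Finset V → k) (F : Finset V) :
    coboundary (fun E => f E + g E) F = coboundary f F + coboundary g F := by
  simp only [coboundary, mul_add, Finset.sum_add_distrib]

lemma coboundary_smul (a : k) (f : Finset V → k) (F : Finset V) :
    coboundary (fun E => a * f E) F = a * coboundary f F := by
  simp only [coboundary, Finset.mul_sum]
  exact Finset.sum_congr rfl fun v _ => by ring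

lemma coboundary_zero (F : Finset V) : coboundary (fun _ => (0 : k)) F = 0 := by
  simp [coboundary]

lemma contractVertex_glueVertex {v : V} (f₀ f₁ : Finset V → k) {F : Finset V} (hv : v ∉ F) :
    contractVertex v (glueVertex v f₀ f₁) F = f₁ F := by
  simp only [contractVertex, glueVertex, Finset.mem_insert_self, if_true, Finset.erase_insert hv]
  rw [← mul_assoc, neg_one_pow_mul_self', one_mul]

lemma glueVertex_of_notMem {v : V} (f₀ f₁ : Finset V → k) {F : Finset V} (hv : v ∉ F) :
    glueVertex v f₀ f₁ F = f₀ F := if_neg hv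

lemma coboundary_glueVertex_of_notMem {v : V} (f₀ f₁ : Finset V → k) {F : Finset V} (hv : v ∉ F) :
    coboundary (glueVertex v f₀ f₁) F = coboundary f₀ F :=
  coboundary_congr fun _ _ => glueVertex_of_notMem _ _ fun h => hv (Finset.mem_of_mem_erase h)

/-- The sign in `contractVertex` counts the vertices above `v`, as if `v` were moved to the last
place. Hence contraction commutes with the coboundary up to the single term that omits `v`. -/
lemma coboundary_insert {v : V} (f : Finset V → k) {F : Finset V} (hv : v ∉ F) :
    coboundary f (insert v F) = (-1) ^ (F.filter (v < ·)).card *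
      ((-1) ^ F.card * f F + coboundary (contractVertex v f) F) := by
  have hcard : F.card = (F.filter (· < v)).card + (F.filter (v < ·)).card := by
    rw [← Finset.card_union_of_disjoint]
    · congr 1
      ext w
      simp only [Finset.mem_union, Finset.mem_filter]
      constructor
      · intro hw
        rcases lt_trichotomy w v with h | h | h
        · exact Or.inl ⟨hw, h⟩
        · exact absurd (h ▸ hw) hv
        · exact Or.inr ⟨hw, h⟩
      · rintro (h | h) <;> exact h.1
    · rw [Finset.disjoint_filter]
      intro w _ h h'
      exact lt_asymm h h'
  rw [coboundary, Finset.sum_insert hv, mul_add]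
  congr 1
  · rw [Finset.filter_insert, if_neg (lt_irrefl v), Finset.erase_insert hv, hcard, pow_add,
      ← mul_assoc, mul_comm ((-1 : k) ^ _) (_ * _), mul_assoc, mul_assoc]
    rw [← mul_assoc ((-1 : k) ^ (F.filter (v < ·)).card), neg_one_pow_mul_self', one_mul]
  · rw [coboundary, Finset.mul_sum]
    refine Finset.sum_congr rfl fun u hu => ?_
    have huv : u ≠ v := fun h => hv (h ▸ hu)
    have e1 : (insert v F).erase u = insert v (F.erase u) := by
      rw [Finset.erase_insert_of_ne huv.symm]
    rw [e1, contractVertex, Finset.filter_insert, Finset.filter_erase]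
    rcases lt_or_gt_of_ne huv with h | h
    · rw [if_neg (lt_asymm h), Finset.erase_eq_of_notMem (a := u) (s := F.filter (v < ·))
        (by simp [lt_asymm h])]
      have := neg_one_pow_mul_self' (k := k) (F.filter (v < ·)).card
      linear_combination (-1) ^ (F.filter (· < u)).card * f (insert v (F.erase u)) * (-this)
    · rw [if_pos h, Finset.card_insert_of_notMem (by simp [hv])]
      have hm : u ∈ F.filter (v < ·) := by simp [hu, h]
      have hc := Finset.card_erase_add_one hm
      have := neg_one_pow_mul_self' (k := k) ((F.filter (v < ·)).erase u).card
      rw [← hc, pow_succ, pow_succ]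
      linear_combination (-1) ^ (F.filter (· < u)).card * f (insert v (F.erase u)) * this

variable {Γ : Finset V → Prop} {v : V} {s : ℕ}

/-- Up to sign, contraction by the apex `v` is a contracting homotopy. -/
lemma IsAcyclicAt.of_cone (h : ∀ F, Γ F → Γ (insert v F)) : IsAcyclicAt k Γ s := by
  intro f hf
  have key : ∀ F, Γ F → v ∉ F → F.card = s →
      (-1) ^ s * f F + coboundary (contractVertex v f) F = 0 := by
    intro F hF hvF hc
    have := hf _ (h F hF) (by rw [Finset.card_insert_of_notMem hvF, hc])
    rw [coboundary_insert f hvF, hc] at this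
    exact (mul_eq_zero.mp this).resolve_left (by simp)
  refine ⟨glueVertex v (fun E => -(-1) ^ s * contractVertex v f E) (fun _ => 0), fun F hF hc => ?_⟩
  by_cases hvF : v ∈ F
  · obtain ⟨E, hvE, rfl⟩ : ∃ E, v ∉ E ∧ insert v E = F :=
      ⟨F.erase v, Finset.notMem_erase v F, Finset.insert_erase hvF⟩
    rw [Finset.card_insert_of_notMem hvE] at hc
    rw [coboundary_insert _ hvE, coboundary_congr (g := fun _ => 0), coboundary_zero,
      glueVertex_of_notMem _ _ hvE, contractVertex, ← hc, pow_succ]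
    · have h1 := neg_one_pow_mul_self' (k := k) E.card
      have h2 := neg_one_pow_mul_self' (k := k) (E.filter (v < ·)).card
      linear_combination f (insert v E) * (-1) ^ E.card * (-1) ^ E.card * h2 +
        f (insert v E) * h1
    · intro w _
      exact contractVertex_glueVertex _ _ fun hw => hvE (Finset.mem_of_mem_erase hw)
  · rw [coboundary_glueVertex_of_notMem _ _ hvF, coboundary_smul]
    have h1 := neg_one_pow_mul_self' (k := k) s
    linear_combination -(-1) ^ s * key F hF hvF hc + f F * h1

/-- This and the next two lemmas are exactness at the three places of the long exact sequence of
link, complex and deletion. Here: the complex, between the link at `s` and the deletion at `s + 1`.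
-/
lemma IsAcyclicAt.of_link_of_deletion
    (hL : IsAcyclicAt k (fun F => v ∉ F ∧ Γ (insert v F)) s)
    (hU : IsAcyclicAt k (fun F => v ∉ F ∧ Γ F) (s + 1)) (hdown : ∀ F, Γ F → Γ (F.erase v)) :
    IsAcyclicAt k Γ (s + 1) := by
  intro f hf
  obtain ⟨g₀, hg₀⟩ := hU f fun F hF hc => hf F hF.2 hc
  have hsub : ∀ F, v ∉ F → Γ (insert v F) → Γ F := fun F hvF hF => by
    simpa [Finset.erase_insert hvF] using hdown _ hF
  -- What `g₀` fails to account for on the faces through `v` is a cocycle of the link.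
  obtain ⟨g₁, hg₁⟩ := hL (fun E => contractVertex v f E + (-1) ^ (s + 1) * g₀ E) (by
    rintro F ⟨hvF, hF⟩ hc
    have := hf _ hF (by rw [Finset.card_insert_of_notMem hvF, hc])
    rw [coboundary_insert f hvF, hc] at this
    have := (mul_eq_zero.mp this).resolve_left (by simp)
    rw [coboundary_add, coboundary_smul, hg₀ F ⟨hvF, hsub F hvF hF⟩ hc]
    linear_combination this)
  refine ⟨glueVertex v g₀ g₁, fun F hF hc => ?_⟩
  by_cases hvF : v ∈ F
  · obtain ⟨E, hvE, rfl⟩ : ∃ E, v ∉ E ∧ insert v E = F :=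
      ⟨F.erase v, Finset.notMem_erase v F, Finset.insert_erase hvF⟩
    rw [Finset.card_insert_of_notMem hvE, Nat.succ_inj] at hc
    rw [coboundary_insert _ hvE, coboundary_congr (g := g₁), hg₁ E ⟨hvE, hF⟩ hc,
      glueVertex_of_notMem _ _ hvE, contractVertex, hc]
    · have h2 := neg_one_pow_mul_self' (k := k) (E.filter (v < ·)).card
      linear_combination f (insert v E) * h2
    · intro w _
      exact contractVertex_glueVertex _ _ fun hw => hvE (Finset.mem_of_mem_erase hw)
  · rw [coboundary_glueVertex_of_notMem _ _ hvF, hg₀ F ⟨hvF, hF⟩ hc]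

/-- Exactness at the link: extended by zero to the faces without `v`, a cocycle of the link becomes
a cocycle of the complex one degree higher. -/
lemma IsAcyclicAt.link
    (h : IsAcyclicAt k Γ (s + 1)) (hU : IsAcyclicAt k (fun F => v ∉ F ∧ Γ F) s)
    (hdown : ∀ F, Γ F → Γ (F.erase v)) :
    IsAcyclicAt k (fun F => v ∉ F ∧ Γ (insert v F)) s := by
  intro f hf
  have hsub : ∀ F, v ∉ F → Γ (insert v F) → Γ F := fun F hvF hF => by
    simpa [Finset.erase_insert hvF] using hdown _ hF
  obtain ⟨g, hg⟩ := h (glueVertex v (fun _ => 0) f) (by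
    intro F hF hc
    by_cases hvF : v ∈ F
    · obtain ⟨E, hvE, rfl⟩ : ∃ E, v ∉ E ∧ insert v E = F :=
        ⟨F.erase v, Finset.notMem_erase v F, Finset.insert_erase hvF⟩
      rw [Finset.card_insert_of_notMem hvE, Nat.succ_inj] at hc
      rw [coboundary_insert _ hvE, coboundary_congr (g := f), hf E ⟨hvE, hF⟩ hc,
        glueVertex_of_notMem _ _ hvE]
      · ring
      · intro w _
        exact contractVertex_glueVertex _ _ fun hw => hvE (Finset.mem_of_mem_erase hw)
    · rw [coboundary_glueVertex_of_notMem _ _ hvF, coboundary_zero])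
  obtain ⟨g', hg'⟩ := hU g (by
    rintro F ⟨hvF, hF⟩ hc
    rw [hg F hF hc, glueVertex_of_notMem _ _ hvF])
  refine ⟨fun E => (-1) ^ s * g' E + contractVertex v g E, ?_⟩
  rintro F ⟨hvF, hF⟩ hc
  have := hg _ hF (by rw [Finset.card_insert_of_notMem hvF, hc])
  have e := contractVertex_glueVertex (v := v) (fun _ => 0) f hvF
  rw [contractVertex, ← this, coboundary_insert g hvF, ← mul_assoc, neg_one_pow_mul_self',
    one_mul, hc] at e
  rw [coboundary_add, coboundary_smul, hg' F ⟨hvF, hsub F hvF hF⟩ hc, e]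

/-- Exactness at the deletion: a cocycle there extends to the whole complex once its restriction to
the link is a coboundary. -/
lemma IsAcyclicAt.deletion
    (h : IsAcyclicAt k Γ s) (hL : IsAcyclicAt k (fun F => v ∉ F ∧ Γ (insert v F)) s)
    (hdown : ∀ F, Γ F → Γ (F.erase v)) :
    IsAcyclicAt k (fun F => v ∉ F ∧ Γ F) s := by
  intro f hf
  have hsub : ∀ F, v ∉ F → Γ (insert v F) → Γ F := fun F hvF hF => by
    simpa [Finset.erase_insert hvF] using hdown _ hF
  obtain ⟨e, he⟩ := hL f fun F hF hc => hf F ⟨hF.1, hsub F hF.1 hF.2⟩ hc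
  obtain ⟨g, hg⟩ := h (glueVertex v f (fun E => -(-1) ^ s * e E)) (by
    intro F hF hc
    by_cases hvF : v ∈ F
    · obtain ⟨E, hvE, rfl⟩ : ∃ E, v ∉ E ∧ insert v E = F :=
        ⟨F.erase v, Finset.notMem_erase v F, Finset.insert_erase hvF⟩
      rw [Finset.card_insert_of_notMem hvE, Nat.succ_inj] at hc
      rw [coboundary_insert _ hvE, coboundary_congr (g := fun E => -(-1) ^ s * e E),
        coboundary_smul, he E ⟨hvE, hF⟩ hc, glueVertex_of_notMem _ _ hvE, hc]
      · ring
      · intro w _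
        exact contractVertex_glueVertex _ _ fun hw => hvE (Finset.mem_of_mem_erase hw)
    · rw [coboundary_glueVertex_of_notMem _ _ hvF, hf F ⟨hvF, hF⟩ hc])
  refine ⟨g, ?_⟩
  rintro F ⟨hvF, hF⟩ hc
  rw [hg F hF hc, glueVertex_of_notMem _ _ hvF]

lemma coboundary_map {V' : Type*} [LinearOrder V'] (φ : V ↪o V') (f : Finset V' → k)
    (F : Finset V) :
    coboundary f (F.map φ.toEmbedding) = coboundary (fun E => f (E.map φ.toEmbedding)) F := by
  rw [coboundary, coboundary, Finset.sum_map]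
  refine Finset.sum_congr rfl fun v _ => ?_
  have h : (F.map φ.toEmbedding).filter (· < φ.toEmbedding v) =
      (F.filter (· < v)).map φ.toEmbedding := by
    ext w
    simp only [Finset.mem_filter, Finset.mem_map]
    constructor
    · rintro ⟨⟨a, ha, rfl⟩, h⟩
      exact ⟨a, ⟨ha, φ.lt_iff_lt.mp h⟩, rfl⟩
    · rintro ⟨a, ⟨ha, h⟩, rfl⟩
      exact ⟨⟨a, ha, rfl⟩, φ.lt_iff_lt.mpr h⟩
  rw [h, Finset.card_map, Finset.map_erase]

lemma isAcyclicAt_map_iff {V' : Type*} [LinearOrder V'] (φ : V ↪o V') {Γ' : Finset V' → Prop}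
    (h : ∀ F', Γ' F' ↔ ∃ F, Γ F ∧ F.map φ.toEmbedding = F') :
    IsAcyclicAt k Γ' s ↔ IsAcyclicAt k Γ s := by
  constructor
  · intro H f hf
    let f' : Finset V' → k := fun E => f (E.preimage φ φ.injective.injOn)
    have hf' : ∀ E : Finset V, f' (E.map φ.toEmbedding) = f E := fun E => by
      simp only [f']
      congr 1
      ext w
      simp
    obtain ⟨g, hg⟩ := H f' (by
      intro F' hF' hc
      obtain ⟨F, hF, rfl⟩ := (h F').mp hF'
      rw [Finset.card_map] at hc
      rw [coboundary_map, ← hf F hF hc]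
      exact coboundary_congr fun v _ => hf' _)
    refine ⟨fun E => g (E.map φ.toEmbedding), fun F hF hc => ?_⟩
    rw [← coboundary_map, hg _ ((h _).mpr ⟨F, hF, rfl⟩) (by rw [Finset.card_map, hc]), hf']
  · intro H f hf
    obtain ⟨g, hg⟩ := H (fun E => f (E.map φ.toEmbedding)) (by
      intro F hF hc
      rw [← coboundary_map]
      exact hf _ ((h _).mpr ⟨F, hF, rfl⟩) (by rw [Finset.card_map, hc]))
    let g' : Finset V' → k := fun E => g (E.preimage φ φ.injective.injOn)
    have hg' : ∀ E : Finset V, g' (E.map φ.toEmbedding) = g E := fun E => by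
      simp only [g']
      congr 1
      ext w
      simp
    refine ⟨g', fun F' hF' hc => ?_⟩
    obtain ⟨F, hF, rfl⟩ := (h F').mp hF'
    rw [Finset.card_map] at hc
    rw [coboundary_map, ← hg F hF hc]
    exact coboundary_congr fun v _ => hg' _

end Cochain

/-! ### Monomials modulo an edge ideal -/

section EdgeIdeal

variable {k : Type*} [Field k] {V : Type*} {G : SimpleGraph V}

lemma edgeIdeal_eq_span_monomial :
    edgeIdeal k G = Ideal.span ((fun m => monomial m (1 : k)) ''
      {m | ∃ u v, G.Adj u v ∧ m = Finsupp.single u 1 + Finsupp.single v 1}) := by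
  rw [edgeIdeal]
  congr 1
  ext p
  constructor
  · rintro ⟨u, v, h, rfl⟩
    exact ⟨_, ⟨u, v, h, rfl⟩, by simp [X, monomial_mul]⟩
  · rintro ⟨_, ⟨u, v, h, rfl⟩, rfl⟩
    exact ⟨u, v, h, by simp [X, monomial_mul]⟩

/-- With `monomial_mem_edgeIdeal`: the monomials of independent support form a basis of the
quotient, whatever their exponents. -/
lemma coeff_eq_zero_of_mem_edgeIdeal {p : MvPolynomial V k} (hp : p ∈ edgeIdeal k G)
    {m : V →₀ ℕ} (hm : G.IsIndepSet (m.support : Set V)) : coeff m p = 0 := by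
  rw [edgeIdeal_eq_span_monomial, mem_ideal_span_monomial_image] at hp
  by_contra h
  obtain ⟨_, ⟨u, v, huv, rfl⟩, hle⟩ := hp m (mem_support_iff.mpr h)
  have hu := hle u
  have hv := hle v
  simp only [Finsupp.add_apply, Finsupp.single_eq_same] at hu hv
  exact hm (by simp; omega) (by simp; omega) huv.ne huv

lemma monomial_mem_edgeIdeal {m : V →₀ ℕ} (hm : ¬ G.IsIndepSet (m.support : Set V)) (a : k) :
    monomial m a ∈ edgeIdeal k G := by
  rw [SimpleGraph.isIndepSet_iff, Set.Pairwise] at hm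
  push Not at hm
  obtain ⟨u, hu, v, hv, hne, huv⟩ := hm
  rw [edgeIdeal_eq_span_monomial, mem_ideal_span_monomial_image]
  classical
  intro x hx
  have hx' : x = m := by
    by_contra h
    rw [mem_support_iff, coeff_monomial, if_neg (Ne.symm h)] at hx
    exact hx rfl
  subst hx'
  refine ⟨_, ⟨u, v, huv, rfl⟩, fun w => ?_⟩
  rw [Finset.mem_coe, Finsupp.mem_support_iff] at hu hv
  rw [Finsupp.add_apply, Finsupp.single_apply, Finsupp.single_apply]
  split_ifs with h1 h2 h2
  · exact absurd (h1.trans h2.symm) hne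
  · subst h1; omega
  · subst h2; omega
  · omega

end EdgeIdeal

/-! ### Multigraded strands of the Koszul complex as cochain complexes -/

section Koszul

variable {k : Type*} [Field k] {V : Type*} [LinearOrder V]

/-- The exponent vector of the squarefree monomial with support `S`. -/
noncomputable def squarefreeExponent (S : Finset V) : V →₀ ℕ := Finsupp.indicator S fun _ _ => 1

lemma squarefreeExponent_apply (S : Finset V) (v : V) :
    squarefreeExponent S v = if v ∈ S then 1 else 0 := by
  simp [squarefreeExponent, Finsupp.indicator_apply]

lemma support_squarefreeExponent (S : Finset V) : (squarefreeExponent S).support = S := by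
  ext v
  simp [squarefreeExponent_apply]

lemma degree_squarefreeExponent (S : Finset V) : (squarefreeExponent S).degree = S.card := by
  rw [Finsupp.degree_apply, support_squarefreeExponent, Finset.card_eq_sum_ones]
  exact Finset.sum_congr rfl fun v hv => by simp [squarefreeExponent_apply, hv]

/-- The sign comparing the coboundary at the faces `W \ T` with the Koszul differential at `T`. -/
def faceSign (k : Type*) [Field k] (W F : Finset V) : k :=
  ∏ u ∈ F, (-1) ^ (W.filter (· < u)).card

lemma faceSign_mul_self (W F : Finset V) : faceSign k W F * faceSign k W F = 1 := by
  rw [faceSign, ← Finset.prod_mul_distrib]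
  exact Finset.prod_eq_one fun u _ => neg_one_pow_mul_self' _

/-- This is the exchange of the Koszul sign at `T` for the simplicial sign at the complementary
face. -/
lemma faceSign_erase {W T : Finset V} (hT : T ⊆ W) {v : V} (hv : v ∈ W \ T) :
    (-1) ^ (T.filter (· < v)).card * faceSign k W ((W \ T).erase v) =
      faceSign k W (W \ T) * (-1) ^ ((W \ T).filter (· < v)).card := by
  have h1 : (W.filter (· < v)).card = (T.filter (· < v)).card + ((W \ T).filter (· < v)).card := by
    rw [← Finset.card_union_of_disjoint, ← Finset.filter_union, Finset.union_sdiff_of_subset hT]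
    exact Finset.disjoint_filter_filter Finset.disjoint_sdiff
  have h2 := Finset.mul_prod_erase (W \ T) (fun u => (-1 : k) ^ (W.filter (· < u)).card) hv
  simp only [faceSign]
  rw [← h2, h1, pow_add]
  have := neg_one_pow_mul_self' (k := k) ((W \ T).filter (· < v)).card
  linear_combination -(-1) ^ (T.filter (· < v)).card *
    (∏ x ∈ (W \ T).erase v, (-1 : k) ^ (W.filter (· < x)).card) * this

lemma sdiff_insert_eq_erase (W T : Finset V) (v : V) : W \ insert v T = (W \ T).erase v := by
  ext w
  simp only [Finset.mem_sdiff, Finset.mem_insert, Finset.mem_erase]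
  tauto

lemma sub_squarefreeExponent_insert (α : V →₀ ℕ) {T : Finset V} {v : V} (hv : v ∉ T) :
    α - squarefreeExponent (insert v T) = α - squarefreeExponent T - Finsupp.single v 1 := by
  ext w
  simp only [Finsupp.tsub_apply, squarefreeExponent_apply, Finset.mem_insert, Finsupp.single_apply]
  by_cases h : w = v
  · subst h; simp [hv]
  · simp [h, Ne.symm h]

lemma squarefreeExponent_le {α : V →₀ ℕ} {S : Finset V} (hS : S ⊆ α.support) :
    squarefreeExponent S ≤ α := fun v => by
  rw [squarefreeExponent_apply]
  split_ifs with h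
  · have := Finsupp.mem_support_iff.mp (hS h)
    omega
  · exact Nat.zero_le _

lemma degree_sub_squarefreeExponent {α : V →₀ ℕ} {S : Finset V} (hS : S ⊆ α.support) :
    (α - squarefreeExponent S).degree = α.degree - S.card := by
  have h : (α - squarefreeExponent S + squarefreeExponent S).degree = α.degree := by
    rw [tsub_add_cancel_of_le (squarefreeExponent_le hS)]
  rw [map_add, degree_squarefreeExponent] at h
  omega

/-- The Koszul chain of multidegree `α` that is given by the cochain `h`. -/
noncomputable def chainOfCochain (I : Ideal (MvPolynomial V k)) (α : V →₀ ℕ) (h : Finset V → k)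
    (S : Finset V) : MvPolynomial V k ⧸ I :=
  if S ⊆ α.support then
    Ideal.Quotient.mk I (monomial (α - squarefreeExponent S)
      (faceSign k α.support (α.support \ S) * h (α.support \ S)))
  else 0

lemma X_mul_monomial_sub (α : V →₀ ℕ) {T : Finset V} {v : V} (hv : v ∉ T) (hα : v ∈ α.support)
    (a : k) : X v * monomial (α - squarefreeExponent (insert v T)) a =
      monomial (α - squarefreeExponent T) a := by
  rw [X, monomial_mul, one_mul]
  suffices hsum : Finsupp.single v 1 + (α - squarefreeExponent (insert v T)) =
      α - squarefreeExponent T by rw [hsum]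
  ext w
  have := Finsupp.mem_support_iff.mp hα
  simp only [Finsupp.add_apply, Finsupp.tsub_apply, squarefreeExponent_apply, Finset.mem_insert,
    Finsupp.single_apply]
  by_cases h : w = v
  · subst h; simp [hv]; omega
  · simp [h, Ne.symm h]

variable [Fintype V]

/-- Passing to complements in the support of `α` turns inserting `v` into `T` into erasing `v` from
a face. -/
lemma koszulDifferential_chainOfCochain (I : Ideal (MvPolynomial V k)) (α : V →₀ ℕ)
    (h : Finset V → k) :
    koszulDifferential I (chainOfCochain I α h) = chainOfCochain I α (coboundary h) := by
  funext T
  change ∑ v ∈ Tᶜ, _ = _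
  by_cases hT : T ⊆ α.support
  · have hsub : α.support \ T ⊆ Tᶜ := fun v hv => by
      rw [Finset.mem_compl]; exact (Finset.mem_sdiff.mp hv).2
    rw [chainOfCochain, if_pos hT, coboundary, Finset.mul_sum, map_sum, map_sum,
      ← Finset.sum_subset hsub]
    · refine Finset.sum_congr rfl fun v hv => ?_
      have hv' := Finset.mem_sdiff.mp hv
      rw [chainOfCochain, if_pos (Finset.insert_subset hv'.1 hT), ← map_mul,
        X_mul_monomial_sub α hv'.2 hv'.1, sdiff_insert_eq_erase, ← mul_assoc, ← faceSign_erase hT hv,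
        mul_assoc]
      have e : ((-1 : MvPolynomial V k ⧸ I)) ^ (T.filter (· < v)).card =
          Ideal.Quotient.mk I (C ((-1) ^ (T.filter (· < v)).card)) := by
        simp
      rw [e, ← map_mul, C_mul_monomial]
    · intro v hv hv'
      rw [chainOfCochain, if_neg, mul_zero, mul_zero]
      intro h'
      exact hv' (Finset.mem_sdiff.mpr ⟨h' (Finset.mem_insert_self _ _), Finset.mem_compl.mp hv⟩)
  · rw [chainOfCochain, if_neg hT]
    refine Finset.sum_eq_zero fun v _ => ?_
    rw [chainOfCochain, if_neg fun h' => hT ((Finset.subset_insert _ _).trans h'), mul_zero,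
      mul_zero]

/-- The cochain of multidegree `α` that is read off from representatives of the coefficients of a
Koszul chain. -/
noncomputable def cochainOfChain (α : V →₀ ℕ) (p : Finset V → MvPolynomial V k) (F : Finset V) : k :=
  faceSign k α.support F * coeff (α - squarefreeExponent (α.support \ F)) (p (α.support \ F))

/-- Chains are residue classes, so coefficients are read from representatives; those at monomials of
independent support do not depend on the choice. -/
lemma coeff_koszulDifferential {I : Ideal (MvPolynomial V k)} (p : Finset V → MvPolynomial V k)
    (α : V →₀ ℕ) {T : Finset V} (hT : T ⊆ α.support) :
    ∃ q, Ideal.Quotient.mk I q = koszulDifferential I (fun S => Ideal.Quotient.mk I (p S)) T ∧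
      coeff (α - squarefreeExponent T) q = faceSign k α.support (α.support \ T) *
        coboundary (cochainOfChain α p) (α.support \ T) := by
  refine ⟨∑ v ∈ Tᶜ, C ((-1) ^ (T.filter (· < v)).card) * (X v * p (insert v T)), ?_, ?_⟩
  · rw [map_sum]
    exact Finset.sum_congr rfl fun v _ => by simp
  · have hsub : α.support \ T ⊆ Tᶜ := fun v hv => by
      rw [Finset.mem_compl]; exact (Finset.mem_sdiff.mp hv).2
    rw [coeff_sum, coboundary, Finset.mul_sum, ← Finset.sum_subset hsub]
    · refine Finset.sum_congr rfl fun v hv => ?_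
      have hv' := Finset.mem_sdiff.mp hv
      rw [coeff_C_mul, coeff_X_mul', if_pos, ← sub_squarefreeExponent_insert α hv'.2, ← mul_assoc,
        ← faceSign_erase hT hv, cochainOfChain, ← sdiff_insert_eq_erase,
        Finset.sdiff_sdiff_eq_self (Finset.insert_subset hv'.1 hT)]
      · have := faceSign_mul_self (k := k) α.support (α.support \ insert v T)
        linear_combination -(-1) ^ (T.filter (· < v)).card *
          coeff (α - squarefreeExponent (insert v T)) (p (insert v T)) * this
      · have := Finsupp.mem_support_iff.mp hv'.1
        simpa [squarefreeExponent_apply, hv'.2] using this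
    · intro v hv hv'
      rw [coeff_C_mul, coeff_X_mul', if_neg, mul_zero]
      intro h
      have hvα : v ∉ α.support := fun h' =>
        hv' (Finset.mem_sdiff.mpr ⟨h', Finset.mem_compl.mp hv⟩)
      rw [Finsupp.notMem_support_iff] at hvα
      simp [hvα] at h

/-- `Module.finrank` is `0` on infinite-dimensional spaces; finiteness makes a nonzero Betti number
equivalent to nonzero homology. -/
instance finite_koszulCycles (I : Ideal (MvPolynomial V k)) (i j : ℕ) :
    Module.Finite k (koszulCycles I i j) := by
  have hfin : Module.Finite k (homogeneousSubmodule V k (j - i)) :=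
    Module.Finite.iff_fg.mpr (homogeneousSubmodule_fg V k (j - i))
  have : Module.Finite k (quotientDegree I (j - i)) := Module.Finite.map _ _
  let φ : koszulCycles I i j →ₗ[k] (Finset V → quotientDegree I (j - i)) :=
    LinearMap.pi fun S => LinearMap.codRestrict _
      ((LinearMap.proj S).comp (koszulCycles I i j).subtype) (by
        intro c
        have := c.2.1 S (Set.mem_univ S)
        dsimp only at this
        split_ifs at this with h
        · exact this
        · change c.1 S ∈ _
          rw [(Submodule.mem_bot k).mp this]
          exact zero_mem _)
  refine Module.Finite.of_injective φ fun c c' h => ?_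
  ext1
  funext S
  exact congrArg Subtype.val (congrFun h S)

lemma gradedBetti_ne_zero_iff (I : Ideal (MvPolynomial V k)) (i j : ℕ) :
    gradedBetti I i j ≠ 0 ↔ ∃ c ∈ koszulCycles I i j, c ∉ koszulBoundaries I i j := by
  rw [gradedBetti, ← Nat.pos_iff_ne_zero, Module.finrank_pos_iff, Submodule.Quotient.nontrivial_iff,
    Ne, Submodule.eq_top_iff']
  push Not
  constructor
  · rintro ⟨c, hc⟩
    exact ⟨c.1, c.2, hc⟩
  · rintro ⟨c, hc, hc'⟩
    exact ⟨⟨c, hc⟩, hc'⟩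

end Koszul

/-! ### Hochster's formula -/

section Hochster

variable {k : Type*} [Field k] {V : Type*} [LinearOrder V]

/-- The faces of the independence complex of the subgraph of `G` induced on `W`. -/
def independentFaces (G : SimpleGraph V) (W : Finset V) (F : Finset V) : Prop :=
  F ⊆ W ∧ G.IsIndepSet (F : Set V)

lemma coboundary_restrict_card (h : Finset V → k) (s : ℕ) (F : Finset V) :
    coboundary (fun E => if E.card = s then h E else 0) F =
      if F.card = s + 1 then coboundary h F else 0 := by
  split_ifs with hc
  · refine coboundary_congr fun v hv => if_pos ?_
    rw [Finset.card_erase_of_mem hv, hc, Nat.add_sub_cancel]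
  · rw [coboundary_congr (g := fun _ => 0), coboundary_zero]
    intro v hv
    refine if_neg fun h' => hc ?_
    rw [← h', Finset.card_erase_add_one hv]

variable {G : SimpleGraph V}

lemma chainOfCochain_mem_koszulChains (I : Ideal (MvPolynomial V k)) (α : V →₀ ℕ)
    (h : Finset V → k) {i : ℕ} (hi : i ≤ α.degree)
    (hh : ∀ S ⊆ α.support, S.card ≠ i → h (α.support \ S) = 0) :
    chainOfCochain I α h ∈ koszulChains I i α.degree := by
  intro S _
  dsimp only
  by_cases hS : S ⊆ α.support
  · by_cases hc : S.card = i
    · rw [if_pos ⟨hc, hi⟩, chainOfCochain, if_pos hS]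
      refine ⟨_, ?_, rfl⟩
      exact isHomogeneous_monomial _ (by rw [degree_sub_squarefreeExponent hS, hc])
    · rw [chainOfCochain, if_pos hS, hh S hS hc, mul_zero, map_zero, map_zero]
      exact zero_mem _
  · rw [chainOfCochain, if_neg hS]
    exact zero_mem _

/-- The faces governing the strand of multidegree `α` of the Koszul complex of the edge ideal. -/
def strandFaces (G : SimpleGraph V) (α : V →₀ ℕ) (F : Finset V) : Prop :=
  F ⊆ α.support ∧ G.IsIndepSet ((α - squarefreeExponent (α.support \ F)).support : Set V)

/-- If `α v ≥ 2`, dividing by `x_v` once does not change the support, so the strand is a cone with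
apex `v`. Only squarefree `α` remain, and these give independence complexes. -/
lemma isAcyclicAt_strandFaces {α : V →₀ ℕ} {i : ℕ} (hi : i ≤ α.support.card)
    (h : ∀ W : Finset V, W.card = α.degree → i ≤ W.card →
      IsAcyclicAt k (independentFaces G W) (W.card - i)) :
    IsAcyclicAt k (strandFaces G α) (α.support.card - i) := by
  by_cases hα : ∃ v, 2 ≤ α v
  · obtain ⟨v, hv⟩ := hα
    refine IsAcyclicAt.of_cone (v := v) fun F hF => ⟨?_, ?_⟩
    · exact Finset.insert_subset (by simp; omega) hF.1
    · have hsupp : (α - squarefreeExponent (α.support \ insert v F)).support =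
          (α - squarefreeExponent (α.support \ F)).support := by
        ext w
        simp only [Finsupp.mem_support_iff, Finsupp.tsub_apply, squarefreeExponent_apply,
          Finset.mem_sdiff, Finset.mem_insert]
        by_cases h : w = v
        · subst h
          split_ifs <;> omega
        · simp [h]
      rw [hsupp]
      exact hF.2
  · push Not at hα
    have hsq : α = squarefreeExponent α.support := by
      ext v
      have := hα v
      rw [squarefreeExponent_apply]
      split_ifs with h
      · have := Finsupp.mem_support_iff.mp h
        omega
      · simpa using h
    have hΓ : strandFaces G α = independentFaces G α.support := by
      funext F
      refine propext (and_congr_right fun hF => ?_)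
      have : (α - squarefreeExponent (α.support \ F)).support = F := by
        ext w
        have h1 := hα w
        rw [Finsupp.mem_support_iff, Finsupp.tsub_apply, squarefreeExponent_apply]
        by_cases h2 : w ∈ F
        · have := Finsupp.mem_support_iff.mp (hF h2)
          simp [h2, this]
        · by_cases h3 : w ∈ α.support
          · simp only [Finset.mem_sdiff, h2, h3, not_false_iff, and_true, if_true, iff_false]
            omega
          · have := Finsupp.notMem_support_iff.mp h3
            simp [h2, this]
      rw [this]
    rw [hΓ]
    refine h _ ?_ hi
    conv_rhs => rw [hsq]
    rw [degree_squarefreeExponent]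

variable [Fintype V]

lemma gradedBetti_ne_zero_of_not_isAcyclicAt {W : Finset V} {s : ℕ}
    (h : ¬ IsAcyclicAt k (independentFaces G W) s) :
    gradedBetti (edgeIdeal k G) (W.card - s) W.card ≠ 0 := by
  rw [gradedBetti_ne_zero_iff]
  rw [IsAcyclicAt] at h
  push Not at h
  obtain ⟨f, hf, hg⟩ := h
  set α := squarefreeExponent W with hα
  have hsupp : α.support = W := support_squarefreeExponent W
  have hdeg : α.degree = W.card := degree_squarefreeExponent W
  have hsub : ∀ T ⊆ W, α - squarefreeExponent T = squarefreeExponent (W \ T) := fun T hT => by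
    ext w
    simp only [hα, Finsupp.tsub_apply, squarefreeExponent_apply, Finset.mem_sdiff]
    by_cases h1 : w ∈ T
    · simp [h1, hT h1]
    · simp [h1]
  refine ⟨chainOfCochain (edgeIdeal k G) α fun E => if E.card = s then f E else 0, ⟨?_, ?_⟩, ?_⟩
  · rw [← hdeg]
    refine chainOfCochain_mem_koszulChains _ _ _ (Nat.sub_le _ _) fun S hS hc => if_neg fun h' => ?_
    rw [Finset.card_sdiff_of_subset hS] at h'
    rw [hsupp] at h' hS
    have := Finset.card_le_card hS
    omega
  · refine LinearMap.mem_ker.mpr ?_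
    rw [koszulDifferential_chainOfCochain]
    funext T
    rw [chainOfCochain, hsupp]
    split_ifs with hT
    · rw [coboundary_restrict_card, hsub T hT]
      split_ifs with hc
      · by_cases hind : G.IsIndepSet ((W \ T : Finset V) : Set V)
        · rw [hf _ ⟨Finset.sdiff_subset, hind⟩ hc, mul_zero, map_zero, map_zero]
          rfl
        · exact Ideal.Quotient.eq_zero_iff_mem.mpr
            (monomial_mem_edgeIdeal (by rwa [support_squarefreeExponent]) _)
      · rw [mul_zero, map_zero, map_zero]
        rfl
    · rfl
  · rintro ⟨b, -, hb⟩
    -- If the cycle bounded `b`, the cochain read off from `b` would be a primitive of `f`: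
    -- coefficients are compared at the monomial of an independent face `F`, which is invisible to
    -- the edge ideal.
    choose p hp using fun S => Ideal.Quotient.mk_surjective (b S)
    obtain ⟨F, ⟨hFW, hF⟩, hc, hne⟩ := hg (cochainOfChain α p)
    apply hne
    have hT : W \ F ⊆ α.support := by rw [hsupp]; exact Finset.sdiff_subset
    obtain ⟨q, hq, hcoeff⟩ := coeff_koszulDifferential (I := edgeIdeal k G) p α hT
    rw [funext hp, hb, chainOfCochain, if_pos hT, Ideal.Quotient.eq] at hq
    have hFF : W \ (W \ F) = F := Finset.sdiff_sdiff_eq_self hFW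
    have := coeff_eq_zero_of_mem_edgeIdeal hq (m := α - squarefreeExponent (W \ F)) (by
      rwa [hsub _ Finset.sdiff_subset, hFF, support_squarefreeExponent])
    rw [coeff_sub, coeff_monomial, if_pos rfl, hcoeff, hsupp, hFF, if_pos hc, ← mul_sub] at this
    have hsign : faceSign k W F ≠ 0 := fun h0 => by
      have := faceSign_mul_self (k := k) W F
      rw [h0] at this
      simp at this
    exact sub_eq_zero.mp ((mul_eq_zero.mp this).resolve_left hsign)

lemma chainOfCochain_mem_koszulBoundaries {α : V →₀ ℕ} {i : ℕ} {p : Finset V → MvPolynomial V k}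
    (hp : ∀ S, S.card ≠ i → p S = 0)
    (hcycle : koszulDifferential (edgeIdeal k G) (fun S => Ideal.Quotient.mk _ (p S)) = 0)
    (h : ∀ W : Finset V, W.card = α.degree → i ≤ W.card →
      IsAcyclicAt k (independentFaces G W) (W.card - i)) :
    chainOfCochain (edgeIdeal k G) α (cochainOfChain α p) ∈
      koszulBoundaries (edgeIdeal k G) i α.degree := by
  have hle : α.support.card ≤ α.degree := by
    rw [Finsupp.degree_apply, Finset.card_eq_sum_ones]
    exact Finset.sum_le_sum fun v hv => Nat.one_le_iff_ne_zero.mpr (Finsupp.mem_support_iff.mp hv)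
  by_cases hi : i ≤ α.support.card
  · obtain ⟨g, hg⟩ := isAcyclicAt_strandFaces hi h (cochainOfChain α p) (by
      intro F hF _
      obtain ⟨q, hq, hcoeff⟩ := coeff_koszulDifferential (I := edgeIdeal k G) p α
        (T := α.support \ F) Finset.sdiff_subset
      rw [hcycle] at hq
      have := coeff_eq_zero_of_mem_edgeIdeal (Ideal.Quotient.eq_zero_iff_mem.mp hq) hF.2
      rw [hcoeff, Finset.sdiff_sdiff_eq_self hF.1] at this
      refine (mul_eq_zero.mp this).resolve_left fun h0 => ?_
      have := faceSign_mul_self (k := k) α.support F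
      rw [h0] at this
      simp at this)
    -- Here the only face in question is `∅`, where a coboundary is an empty sum; the chain itself
    -- vanishes.
    by_cases hi' : i = α.support.card
    · have hz : chainOfCochain (edgeIdeal k G) α (cochainOfChain α p) = 0 := by
        funext T
        rw [chainOfCochain]
        split_ifs with hT
        · by_cases hF : strandFaces G α (α.support \ T)
          · by_cases hc : (α.support \ T).card = α.support.card - i
            · rw [← hg _ hF hc]
              have : α.support \ T = ∅ := by
                rw [← Finset.card_eq_zero]; omega
              rw [this, coboundary, Finset.sum_empty, mul_zero, map_zero, map_zero]
              rfl
            · have : T.card ≠ i := by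
                intro h'
                rw [Finset.card_sdiff_of_subset hT, h'] at hc
                exact hc rfl
              rw [cochainOfChain, Finset.sdiff_sdiff_eq_self hT, hp T this, coeff_zero, mul_zero,
                mul_zero, map_zero, map_zero]
              rfl
          · refine Ideal.Quotient.eq_zero_iff_mem.mpr (monomial_mem_edgeIdeal (fun h' => hF ?_) _)
            exact ⟨Finset.sdiff_subset, by rwa [Finset.sdiff_sdiff_eq_self hT]⟩
        · rfl
      rw [hz]
      exact zero_mem _
    · obtain ⟨t, ht⟩ : ∃ t, α.support.card - i = t + 1 := ⟨α.support.card - i - 1, by omega⟩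
      refine ⟨chainOfCochain (edgeIdeal k G) α fun E => if E.card = t then g E else 0, ?_, ?_⟩
      · refine chainOfCochain_mem_koszulChains _ _ _ (by omega) fun S hS hc => if_neg fun h' => ?_
        rw [Finset.card_sdiff_of_subset hS] at h'
        have := Finset.card_le_card hS
        omega
      · rw [koszulDifferential_chainOfCochain]
        funext T
        rw [chainOfCochain, chainOfCochain]
        split_ifs with hT
        · rw [coboundary_restrict_card]
          by_cases hF : strandFaces G α (α.support \ T)
          · split_ifs with hc
            · rw [hg _ hF (by omega)]
            · have : T.card ≠ i := by
                intro h'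
                rw [Finset.card_sdiff_of_subset hT, h'] at hc
                exact hc ht
              rw [cochainOfChain, Finset.sdiff_sdiff_eq_self hT, hp T this, coeff_zero, mul_zero,
                mul_zero]
          · have hn : ¬ G.IsIndepSet ((α - squarefreeExponent T).support : Set V) := fun h' => hF
              ⟨Finset.sdiff_subset, by rwa [Finset.sdiff_sdiff_eq_self hT]⟩
            rw [Ideal.Quotient.eq_zero_iff_mem.mpr (monomial_mem_edgeIdeal hn _),
              Ideal.Quotient.eq_zero_iff_mem.mpr (monomial_mem_edgeIdeal hn _)]
        · rfl
  · have hz : chainOfCochain (edgeIdeal k G) α (cochainOfChain α p) = 0 := by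
      funext T
      rw [chainOfCochain]
      split_ifs with hT
      · have : T.card ≠ i := by
          have := Finset.card_le_card hT
          omega
        rw [cochainOfChain, Finset.sdiff_sdiff_eq_self hT, hp T this, coeff_zero, mul_zero,
          mul_zero, map_zero, map_zero]
        rfl
      · rfl
    rw [hz]
    exact zero_mem _

/-- Decomposition of a chain into its multihomogeneous components: the monomial `m` at `e_S` has
multidegree `m + squarefreeExponent S`. -/
lemma sum_chainOfCochain {i j : ℕ} (hij : i ≤ j) {p : Finset V → MvPolynomial V k}
    (hp : ∀ S, S.card ≠ i → p S = 0) (hp' : ∀ S, (p S).IsHomogeneous (j - i))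
    (I : Ideal (MvPolynomial V k)) :
    ∑ α ∈ Finset.finsuppAntidiag Finset.univ j, chainOfCochain I α (cochainOfChain α p) =
      fun S => Ideal.Quotient.mk I (p S) := by
  funext S
  rw [Finset.sum_apply]
  have h0 : ∀ α : V →₀ ℕ, chainOfCochain I α (cochainOfChain α p) S =
      if S ⊆ α.support then Ideal.Quotient.mk I (monomial (α - squarefreeExponent S)
        (coeff (α - squarefreeExponent S) (p S))) else 0 := fun α => by
    rw [chainOfCochain]
    split_ifs with hS
    · rw [cochainOfChain, Finset.sdiff_sdiff_eq_self hS, ← mul_assoc, faceSign_mul_self, one_mul]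
    · rfl
  simp only [h0]
  rw [← Finset.sum_filter]
  conv_rhs => rw [(p S).as_sum]
  rw [map_sum]
  symm
  by_cases hS : S.card = i
  swap
  · rw [hp S hS]; simp
  refine Finset.sum_of_injOn (fun m => m + squarefreeExponent S) ?_ ?_ ?_ ?_
  · intro a _ b _ h
    exact add_right_cancel h
  · intro m hm
    have hdeg : m.degree = j - i := by
      by_contra h
      exact mem_support_iff.mp hm ((hp' S).coeff_eq_zero h)
    rw [Finset.mem_coe, Finset.mem_filter, Finset.mem_finsuppAntidiag]
    refine ⟨⟨?_, Finset.subset_univ _⟩, fun v hv => ?_⟩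
    · rw [← Finsupp.degree_eq_sum, map_add, degree_squarefreeExponent, hdeg, hS]
      omega
    · simp [squarefreeExponent_apply, hv]
  · intro α hα hα'
    rw [Finset.mem_filter] at hα
    have : coeff (α - squarefreeExponent S) (p S) = 0 := by
      by_contra h
      refine hα' ⟨_, mem_support_iff.mpr h, ?_⟩
      exact tsub_add_cancel_of_le (squarefreeExponent_le hα.2)
    rw [this, map_zero, map_zero]
  · intro m _
    simp only [add_tsub_cancel_right]

/-- Hochster's formula, as far as the vanishing of the graded Betti numbers is concerned. -/
theorem gradedBetti_edgeIdeal_ne_zero_iff (i j : ℕ) :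
    gradedBetti (edgeIdeal k G) i j ≠ 0 ↔
      ∃ W : Finset V, W.card = j ∧ i ≤ j ∧ ¬ IsAcyclicAt k (independentFaces G W) (j - i) := by
  constructor
  · rw [gradedBetti_ne_zero_iff]
    rintro ⟨c, ⟨hchain, hcycle⟩, hb⟩
    by_contra! hW
    by_cases hij : i ≤ j
    · have hex : ∀ S, ∃ q : MvPolynomial V k, Ideal.Quotient.mk (edgeIdeal k G) q = c S ∧
          q.IsHomogeneous (j - i) ∧ (S.card ≠ i → q = 0) := by
        intro S
        have := hchain S (Set.mem_univ S)
        dsimp only at this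
        split_ifs at this with h
        · obtain ⟨q, hq, hq'⟩ := this
          exact ⟨q, hq', hq, fun h' => absurd h.1 h'⟩
        · exact ⟨0, by rw [(Submodule.mem_bot k).mp this, map_zero], isHomogeneous_zero _ _ _, fun _ => rfl⟩
      choose p hp hhom hzero using hex
      have hc : c = fun S => Ideal.Quotient.mk (edgeIdeal k G) (p S) := funext fun S => (hp S).symm
      apply hb
      rw [hc, ← sum_chainOfCochain hij hzero hhom]
      refine Submodule.sum_mem _ fun α hα => ?_
      rw [Finset.mem_finsuppAntidiag, ← Finsupp.degree_eq_sum] at hα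
      obtain ⟨rfl, -⟩ := hα
      refine chainOfCochain_mem_koszulBoundaries hzero (hc ▸ hcycle) fun W hWc hi => ?_
      rw [hWc]
      exact hW W hWc (hWc ▸ hi)
    · apply hb
      have : c = 0 := by
        funext S
        have := hchain S (Set.mem_univ S)
        dsimp only at this
        rw [if_neg (fun h => hij h.2)] at this
        exact (Submodule.mem_bot k).mp this
      rw [this]
      exact zero_mem _
  · rintro ⟨W, rfl, hi, h⟩
    have := gradedBetti_ne_zero_of_not_isAcyclicAt h
    rwa [Nat.sub_sub_self hi] at this

end Hochster

/-! ### Cohomology of independence complexes -/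

section IndependenceComplex

variable {k : Type*} [Field k] {V : Type*} [LinearOrder V] {G : SimpleGraph V} {W : Finset V}
  {v : V} {s : ℕ}

open Classical in
/-- The vertices of `W` that are different from `v` and not adjacent to `v`. -/
noncomputable def nonNeighbors (G : SimpleGraph V) (W : Finset V) (v : V) : Finset V :=
  W.filter fun w => w ≠ v ∧ ¬ G.Adj v w

lemma mem_nonNeighbors {w : V} : w ∈ nonNeighbors G W v ↔ w ∈ W ∧ w ≠ v ∧ ¬ G.Adj v w := by
  simp [nonNeighbors]

lemma isIndepSet_insert {F : Finset V} (hind : G.IsIndepSet (F : Set V))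
    (h : ∀ w ∈ F, ¬ G.Adj v w) : G.IsIndepSet ((insert v F : Finset V) : Set V) := by
  intro a ha b hb hab
  rw [Finset.mem_coe, Finset.mem_insert] at ha hb
  rcases ha with rfl | ha <;> rcases hb with rfl | hb
  · exact absurd rfl hab
  · exact h b hb
  · exact fun h' => h a ha h'.symm
  · exact hind ha hb hab

/-- The reduced cohomology of the independence complex of the subgraph of `G` induced on `W`
vanishes at the faces with `s` vertices. -/
def IsGraphAcyclicAt (k : Type*) [Field k] (G : SimpleGraph V) (W : Finset V) (s : ℕ) : Prop :=
  IsAcyclicAt k (independentFaces G W) s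

lemma independentFaces_erase (F : Finset V) (h : independentFaces G W F) :
    independentFaces G W (F.erase v) :=
  ⟨(Finset.erase_subset _ _).trans h.1, h.2.mono (Finset.coe_subset.mpr (Finset.erase_subset _ _))⟩

lemma deletion_independentFaces :
    (fun F => v ∉ F ∧ independentFaces G W F) = independentFaces G (W.erase v) := by
  funext F
  simp only [independentFaces, Finset.subset_erase, eq_iff_iff]
  tauto

lemma link_independentFaces (hv : v ∈ W) :
    (fun F => v ∉ F ∧ independentFaces G W (insert v F)) =
      independentFaces G (nonNeighbors G W v) := by
  funext F
  rw [eq_iff_iff]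
  constructor
  · rintro ⟨hvF, hsub, hind⟩
    refine ⟨fun w hw => ?_, hind.mono (by simp)⟩
    have hne : w ≠ v := fun h => hvF (h ▸ hw)
    exact mem_nonNeighbors.mpr ⟨hsub (Finset.mem_insert_of_mem hw), hne,
      hind (by simp) (by simp [hw]) hne.symm⟩
  · rintro ⟨hsub, hind⟩
    refine ⟨fun h => (mem_nonNeighbors.mp (hsub h)).2.1 rfl, ?_, ?_⟩
    · exact Finset.insert_subset hv fun w hw => (mem_nonNeighbors.mp (hsub hw)).1
    · exact isIndepSet_insert hind fun w hw => (mem_nonNeighbors.mp (hsub hw)).2.2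

namespace IsGraphAcyclicAt

lemma of_forall_card_ne (h : ∀ F ⊆ W, F.card ≠ s) : IsGraphAcyclicAt k G W s :=
  fun _ _ => ⟨fun _ => 0, fun F hF hc => absurd hc (h F hF.1)⟩

lemma zero_of_mem (hv : v ∈ W) : IsGraphAcyclicAt k G W 0 := by
  intro f hf
  refine ⟨fun _ => 0, fun F _ hc => ?_⟩
  rw [Finset.card_eq_zero] at hc
  subst hc
  have := hf {v} ⟨by simpa using hv, by simp [SimpleGraph.isIndepSet_iff]⟩ (by simp)
  rw [coboundary_zero]
  exact (by simpa [coboundary] using this : f ∅ = 0).symm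

lemma of_isolated (hv : v ∈ W) (h : ∀ w ∈ W, ¬ G.Adj v w) : IsGraphAcyclicAt k G W s := by
  refine IsAcyclicAt.of_cone (v := v) fun F hF => ⟨Finset.insert_subset hv hF.1, ?_⟩
  exact isIndepSet_insert hF.2 fun w hw => h w (hF.1 hw)

lemma of_nonNeighbors_of_erase (hv : v ∈ W)
    (hL : ∀ t, s = t + 1 → IsGraphAcyclicAt k G (nonNeighbors G W v) t)
    (hU : IsGraphAcyclicAt k G (W.erase v) s) : IsGraphAcyclicAt k G W s := by
  cases s with
  | zero => exact zero_of_mem hv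
  | succ t =>
    refine IsAcyclicAt.of_link_of_deletion (v := v) ?_ ?_ independentFaces_erase
    · rw [link_independentFaces hv]; exact hL t rfl
    · rw [deletion_independentFaces]; exact hU

lemma nonNeighbors (hv : v ∈ W) (h : IsGraphAcyclicAt k G W (s + 1))
    (hU : IsGraphAcyclicAt k G (W.erase v) s) :
    IsGraphAcyclicAt k G (nonNeighbors G W v) s := by
  rw [IsGraphAcyclicAt, ← link_independentFaces hv]
  refine IsAcyclicAt.link h ?_ independentFaces_erase
  rw [deletion_independentFaces]; exact hU

lemma erase (hv : v ∈ W) (h : IsGraphAcyclicAt k G W s)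
    (hL : IsGraphAcyclicAt k G (_root_.nonNeighbors G W v) s) :
    IsGraphAcyclicAt k G (W.erase v) s := by
  rw [IsGraphAcyclicAt, ← deletion_independentFaces]
  refine IsAcyclicAt.deletion h ?_ independentFaces_erase
  rw [link_independentFaces hv]; exact hL

lemma nonNeighbors_of_dominated {u : V} (hu : u ∈ W) (huv : u ≠ v) (hadj : ¬ G.Adj v u)
    (h : ∀ w ∈ W, G.Adj u w → G.Adj v w) :
    IsGraphAcyclicAt k G (_root_.nonNeighbors G W v) s :=
  of_isolated (mem_nonNeighbors.mpr ⟨hu, huv, hadj⟩) fun w hw huw =>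
    (mem_nonNeighbors.mp hw).2.2 (h w (mem_nonNeighbors.mp hw).1 huw)

/-- The fold lemma: the link of `v` is a cone with apex `u`, so deleting `v` changes no cohomology.
-/
lemma iff_erase_of_dominated {u : V} (hv : v ∈ W) (hu : u ∈ W) (huv : u ≠ v) (hadj : ¬ G.Adj v u)
    (h : ∀ w ∈ W, G.Adj u w → G.Adj v w) :
    IsGraphAcyclicAt k G W s ↔ IsGraphAcyclicAt k G (W.erase v) s :=
  ⟨fun H => H.erase hv (nonNeighbors_of_dominated hu huv hadj h), fun H =>
    of_nonNeighbors_of_erase hv (fun _ _ => nonNeighbors_of_dominated hu huv hadj h) H⟩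

lemma not_empty_zero : ¬ IsGraphAcyclicAt k G ∅ 0 := by
  intro h
  obtain ⟨g, hg⟩ := h (fun _ => 1) (by
    intro F hF hc
    rw [Finset.subset_empty.mp hF.1] at hc
    simp at hc)
  have := hg ∅ ⟨subset_rfl, by simp [SimpleGraph.isIndepSet_iff]⟩ rfl
  simp [coboundary] at this

/-- Without isolated vertices `U` is a perfect matching. Deleting an end `v` of an edge `vq`
isolates `q`, so the class survives in the link of `v`, which is the matching without that edge, one
degree lower. -/
lemma card_eq_of_not {U : Finset V}
    (hdeg : ∀ v ∈ U, ∀ a ∈ U, ∀ b ∈ U, G.Adj v a → G.Adj v b → a = b)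
    (h : ¬ IsGraphAcyclicAt k G U s) : U.card = 2 * s ∧ ∀ v ∈ U, ∃ w ∈ U, G.Adj v w := by
  have hiso : ∀ v ∈ U, ∃ w ∈ U, G.Adj v w := by
    intro v hv
    by_contra! hcon
    exact h (of_isolated hv hcon)
  refine ⟨?_, hiso⟩
  induction s generalizing U with
  | zero =>
    rcases U.eq_empty_or_nonempty with rfl | ⟨v, hv⟩
    · rfl
    · exact absurd (zero_of_mem hv) h
  | succ t ih =>
    rcases U.eq_empty_or_nonempty with rfl | ⟨v, hv⟩
    · exact absurd (of_forall_card_ne fun F hF hc => by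
        rw [Finset.subset_empty.mp hF] at hc; simp at hc) h
    obtain ⟨q, hq, hvq⟩ := hiso v hv
    have hqv : q ≠ v := hvq.ne.symm
    have hL : ¬ IsGraphAcyclicAt k G (_root_.nonNeighbors G U v) t := by
      intro hL
      refine h (of_nonNeighbors_of_erase hv (fun t' ht' => ?_) ?_)
      · cases ht'; exact hL
      · refine of_isolated (Finset.mem_erase.mpr ⟨hqv, hq⟩) fun w hw hqw => ?_
        exact Finset.ne_of_mem_erase hw
          (hdeg q hq w (Finset.mem_of_mem_erase hw) v hv hqw hvq.symm)
    have hsub : ∀ w ∈ _root_.nonNeighbors G U v, w ∈ U := fun w hw => (mem_nonNeighbors.mp hw).1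
    have hdeg' : ∀ w ∈ _root_.nonNeighbors G U v, ∀ a ∈ _root_.nonNeighbors G U v,
        ∀ b ∈ _root_.nonNeighbors G U v, G.Adj w a → G.Adj w b → a = b := fun w hw a ha b hb =>
      hdeg w (hsub w hw) a (hsub a ha) b (hsub b hb)
    have hc := ih hdeg' hL (by
      intro w hw
      by_contra! hcon
      exact hL (of_isolated hw hcon))
    have hU : _root_.nonNeighbors G U v = (U.erase v).erase q := by
      ext w
      rw [mem_nonNeighbors, Finset.mem_erase, Finset.mem_erase]
      constructor
      · rintro ⟨hw, hwv, hadj⟩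
        exact ⟨fun h' => hadj (h' ▸ hvq), hwv, hw⟩
      · rintro ⟨hwq, hwv, hw⟩
        exact ⟨hw, hwv, fun h' => hwq (hdeg v hv w hw q hq h' hvq)⟩
    rw [hU] at hc
    have h1 := Finset.card_erase_add_one (Finset.mem_erase.mpr ⟨hqv, hq⟩)
    have h2 := Finset.card_erase_add_one hv
    omega

lemma map_iff {V' : Type*} [LinearOrder V'] (φ : V ↪o V') {G' : SimpleGraph V'}
    (hG : ∀ a b, G'.Adj (φ a) (φ b) ↔ G.Adj a b) :
    IsGraphAcyclicAt k G' (W.map φ.toEmbedding) s ↔ IsGraphAcyclicAt k G W s := by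
  refine isAcyclicAt_map_iff φ fun F' => ⟨?_, ?_⟩
  · rintro ⟨hsub, hind⟩
    obtain ⟨F, hF, rfl⟩ := Finset.subset_map_iff.mp hsub
    refine ⟨F, ⟨hF, fun a ha b hb hab => ?_⟩, rfl⟩
    change ¬ G.Adj a b
    rw [← hG]
    exact hind (by simpa using ha) (by simpa using hb) (φ.injective.ne hab)
  · rintro ⟨F, ⟨hF, hind⟩, rfl⟩
    refine ⟨Finset.map_subset_map.mpr hF, ?_⟩
    rw [SimpleGraph.isIndepSet_iff, Finset.coe_map]
    rintro _ ⟨a, ha, rfl⟩ _ ⟨b, hb, rfl⟩ hab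
    change ¬ G'.Adj (φ a) (φ b)
    rw [hG]
    exact hind ha hb fun h => hab (by rw [h])

/-- A maximal independent set `F` of `G` bounds the projective dimension of the edge ideal from
below. -/
lemma exists_not_of_maximal_independent [Fintype V] {F : Finset V}
    (hF : G.IsIndepSet (F : Set V)) (hmax : ∀ v ∉ F, ∃ u ∈ F, G.Adj u v) :
    ∃ (W : Finset V) (s : ℕ), ¬ IsGraphAcyclicAt k G W s ∧ Fᶜ.card + s ≤ W.card := by
  classical
  -- The vertices of `F` are released one by one into `R`. Cohomology is taken on the vertices of
  -- `W` not adjacent to the unreleased ones, but the bound counts all of `W`; by maximality one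
  -- starts from `Fᶜ`, filtered down to `∅`.
  have key : ∀ R ⊆ F, ∃ (W : Finset V) (s : ℕ), Disjoint W (F \ R) ∧
      ¬ IsGraphAcyclicAt k G (W.filter fun w => ∀ u ∈ F \ R, ¬ G.Adj u w) s ∧
        Fᶜ.card + s ≤ W.card := by
    intro R
    induction R using Finset.induction_on with
    | empty =>
      intro _
      refine ⟨Fᶜ, 0, ?_, ?_, le_rfl⟩
      · rw [Finset.sdiff_empty]; exact disjoint_compl_left
      · rw [Finset.sdiff_empty, Finset.filter_eq_empty_iff.mpr]
        · exact not_empty_zero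
        · intro w hw hcon
          obtain ⟨u, hu, huw⟩ := hmax w (Finset.mem_compl.mp hw)
          exact hcon u hu huw
    | insert v R hvR ih =>
      intro hR
      obtain ⟨hvF, hR⟩ := Finset.insert_subset_iff.mp hR
      obtain ⟨W, s, hdisj, hW, hcard⟩ := ih hR
      have hFR : F \ R = insert v (F \ insert v R) := by
        ext w
        simp only [Finset.mem_sdiff, Finset.mem_insert]
        by_cases h : w = v
        · subst h; simp [hvF, hvR]
        · simp [h]
      rw [hFR, Finset.disjoint_insert_right] at hdisj
      obtain ⟨hvW, hdisj⟩ := hdisj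
      set T := F \ insert v R with hT
      have hvT : v ∉ T := by simp [hT]
      set A := (insert v W).filter fun w => ∀ u ∈ T, ¬ G.Adj u w with hA
      have hvA : v ∈ A := by
        refine Finset.mem_filter.mpr ⟨Finset.mem_insert_self _ _, fun u hu => ?_⟩
        exact hF (Finset.mem_sdiff.mp hu).1 hvF fun h => hvT (h ▸ hu)
      have hlink : _root_.nonNeighbors G A v = W.filter fun w => ∀ u ∈ F \ R, ¬ G.Adj u w := by
        ext w
        rw [mem_nonNeighbors, hA, Finset.mem_filter, Finset.mem_filter, hFR]
        simp only [Finset.mem_insert, forall_eq_or_imp]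
        constructor
        · rintro ⟨⟨h1, h2⟩, h3, h4⟩
          exact ⟨h1.resolve_left h3, h4, h2⟩
        · rintro ⟨h1, h2, h3⟩
          exact ⟨⟨Or.inr h1, h3⟩, fun h => hvW (h ▸ h1), h2⟩
      have hdel : A.erase v = W.filter fun w => ∀ u ∈ T, ¬ G.Adj u w := by
        rw [hA, ← Finset.filter_erase, Finset.erase_insert hvW]
      -- The link of `v` in `A` carries the previous class. Either it lifts to `A`, raising `|W|`
      -- and `s` by one, or the deletion is already not acyclic at `s`.
      by_cases hdelW : IsGraphAcyclicAt k G (A.erase v) s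
      · refine ⟨insert v W, s + 1, ?_, fun h => hW ?_, ?_⟩
        · rw [Finset.disjoint_insert_left]
          exact ⟨hvT, hdisj⟩
        · rw [← hlink]
          exact IsGraphAcyclicAt.nonNeighbors hvA h hdelW
        · rw [Finset.card_insert_of_notMem hvW]
          omega
      · refine ⟨W, s, hdisj, ?_, hcard⟩
        rwa [← hdel]
  obtain ⟨W, s, -, hW, hcard⟩ := key F subset_rfl
  refine ⟨_, s, hW, ?_⟩
  simpa using hcard

end IsGraphAcyclicAt

end IndependenceComplex

/-! ### Adjacency and induced subgraphs in the suspension -/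

section Suspension

variable {k : Type*} [Field k] {V : Type*} {G : SimpleGraph V} {C : Set V}

lemma suspension_adj_coe_coe {u v : V} :
    (suspension G C).Adj (u : WithTop V) (v : WithTop V) ↔ G.Adj u v := by
  constructor
  · rintro (⟨a, b, ha, hb, h⟩ | ⟨a, _, ha, _⟩ | ⟨a, _, _, hb⟩)
    · rwa [WithTop.coe_injective ha, WithTop.coe_injective hb]
    · exact absurd ha WithTop.coe_ne_top
    · exact absurd hb WithTop.coe_ne_top
  · exact fun h => Or.inl ⟨u, v, rfl, rfl, h⟩

lemma suspension_adj_top_coe {u : V} :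
    (suspension G C).Adj ⊤ (u : WithTop V) ↔ u ∈ C := by
  constructor
  · rintro (⟨a, b, ha, hb, h⟩ | ⟨a, h, _, hb⟩ | ⟨a, _, ha, _⟩)
    · exact absurd ha.symm WithTop.coe_ne_top
    · rwa [WithTop.coe_injective hb]
    · exact absurd ha.symm WithTop.coe_ne_top
  · exact fun h => Or.inr (Or.inl ⟨u, h, rfl, rfl⟩)

lemma suspension_adj_coe_top {u : V} :
    (suspension G C).Adj (u : WithTop V) ⊤ ↔ u ∈ C := by
  rw [SimpleGraph.adj_comm, suspension_adj_top_coe]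

variable [LinearOrder V]

lemma IsGraphAcyclicAt.suspension_map_iff {W : Finset V} {s : ℕ} :
    IsGraphAcyclicAt k (suspension G C) (W.map WithTop.coeOrderHom.toEmbedding) s ↔
      IsGraphAcyclicAt k G W s :=
  IsGraphAcyclicAt.map_iff _ fun _ _ => suspension_adj_coe_coe

lemma mem_map_coeOrderHom {W : Finset V} {v : V} :
    (v : WithTop V) ∈ W.map WithTop.coeOrderHom.toEmbedding ↔ v ∈ W := by
  simp only [Finset.mem_map]
  constructor
  · rintro ⟨a, ha, h⟩
    rwa [← WithTop.coe_injective h]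
  · exact fun h => ⟨v, h, rfl⟩

lemma top_notMem_map_coeOrderHom {W : Finset V} :
    ⊤ ∉ W.map WithTop.coeOrderHom.toEmbedding := by
  simp only [Finset.mem_map]
  rintro ⟨a, _, h⟩
  exact WithTop.coe_ne_top h

lemma exists_eq_map_coeOrderHom {W : Finset (WithTop V)} (h : ⊤ ∉ W) :
    ∃ U : Finset V, U.map WithTop.coeOrderHom.toEmbedding = W := by
  refine ⟨W.preimage _ WithTop.coe_injective.injOn, ?_⟩
  ext x
  induction x using WithTop.recTopCoe with
  | top => exact iff_of_false top_notMem_map_coeOrderHom h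
  | coe v => rw [mem_map_coeOrderHom, Finset.mem_preimage]

end Suspension

/-! ### Maximal independent sets along a cyclic rotation and their gaps -/

section Rotation

variable {V : Type*} [LinearOrder V] {G : SimpleGraph V} {σ : Equiv.Perm V} {C : Finset V}

/-- For the successor `σ` along a cycle: `C` is a maximal independent set. -/
structure IsMaximalIndependentCyclic (σ : Equiv.Perm V) (C : Finset V) : Prop where
  succ_notMem : ∀ d ∈ C, σ d ∉ C
  mem_or_mem : ∀ v ∉ C, σ v ∈ C ∨ σ.symm v ∈ C

namespace IsMaximalIndependentCyclic

-- By maximality one of the two neighbours of `v` lies in `C`, which leaves at most one in `U`.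
omit [LinearOrder V] in
lemma neighbor_unique (hC : IsMaximalIndependentCyclic σ C)
    (hadj : ∀ u v, G.Adj u v ↔ v = σ u ∨ u = σ v) {U : Finset V} (hU : Disjoint U C) :
    ∀ v ∈ U, ∀ a ∈ U, ∀ b ∈ U, G.Adj v a → G.Adj v b → a = b := by
  have hU' : ∀ v ∈ U, v ∉ C := fun v hv hv' => Finset.disjoint_left.mp hU hv hv'
  intro v hv a ha b hb hva hvb
  rw [hadj] at hva hvb
  rcases hva with rfl | rfl <;> rcases hvb with h | h
  · exact h.symm
  · subst h
    rcases hC.mem_or_mem _ (hU' _ hv) with h' | h'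
    · exact absurd h' (hU' _ ha)
    · rw [Equiv.symm_apply_apply] at h'
      exact absurd h' (hU' _ hb)
  · subst h
    rcases hC.mem_or_mem _ (hU' _ hv) with h' | h'
    · exact absurd h' (hU' _ hb)
    · rw [Equiv.symm_apply_apply] at h'
      exact absurd h' (hU' _ ha)
  · exact σ.injective h

variable [Fintype V]

/-- The vertices outside `C` whose successor is outside `C`. -/
def gapPairs (σ : Equiv.Perm V) (C : Finset V) : Finset V := Cᶜ.filter fun p => σ p ∉ C

lemma mem_gapPairs {p : V} : p ∈ gapPairs σ C ↔ p ∉ C ∧ σ p ∉ C := by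
  rw [gapPairs, Finset.mem_filter, Finset.mem_compl]

/-- A vertex outside `C` is the successor either of a vertex of `C` or of the first vertex of a
two-vertex gap. -/
lemma card_compl (hC : IsMaximalIndependentCyclic σ C) :
    Cᶜ.card = C.card + (gapPairs σ C).card := by
  have h : Cᶜ = C.map σ.toEmbedding ∪ (gapPairs σ C).map σ.toEmbedding := by
    ext v
    rw [Finset.mem_union, Finset.mem_map_equiv, Finset.mem_map_equiv, mem_gapPairs,
      Equiv.apply_symm_apply, Finset.mem_compl]
    constructor
    · intro h
      by_cases h' : σ.symm v ∈ C
      · exact Or.inl h'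
      · exact Or.inr ⟨h', h⟩
    · rintro (h | h)
      · simpa using hC.succ_notMem _ h
      · exact h.2
  rw [h, Finset.card_union_of_disjoint, Finset.card_map, Finset.card_map]
  rw [Finset.disjoint_map, Finset.disjoint_left]
  exact fun v hv hv' => (mem_gapPairs.mp hv').1 hv

lemma map_symm_gapPairs_subset (hC : IsMaximalIndependentCyclic σ C) :
    (gapPairs σ C).map σ.symm.toEmbedding ⊆ C := by
  intro v hv
  rw [Finset.mem_map_equiv, Equiv.symm_symm, mem_gapPairs] at hv
  have := (hC.mem_or_mem _ hv.1).resolve_left hv.2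
  rwa [Equiv.symm_apply_apply] at this

lemma card_gapPairs_le (hC : IsMaximalIndependentCyclic σ C) : (gapPairs σ C).card ≤ C.card := by
  simpa using Finset.card_le_card hC.map_symm_gapPairs_subset

lemma matching_subset_gapPairs {U : Finset V} (hU : Disjoint U C) :
    U.filter (fun p => σ p ∈ U) ⊆ gapPairs σ C := by
  intro p hp
  rw [Finset.mem_filter] at hp
  exact mem_gapPairs.mpr ⟨Finset.disjoint_left.mp hU hp.1, Finset.disjoint_left.mp hU hp.2⟩

omit [Fintype V] in
lemma card_matching_le (hadj : ∀ u v, G.Adj u v ↔ v = σ u ∨ u = σ v) {U : Finset V}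
    (hiso : ∀ v ∈ U, ∃ w ∈ U, G.Adj v w) :
    U.card ≤ 2 * (U.filter fun p => σ p ∈ U).card := by
  have h : U ⊆ (U.filter fun p => σ p ∈ U) ∪ (U.filter fun p => σ p ∈ U).map σ.toEmbedding := by
    intro v hv
    obtain ⟨w, hw, hvw⟩ := hiso v hv
    rw [hadj] at hvw
    rw [Finset.mem_union, Finset.mem_map_equiv, Finset.mem_filter, Finset.mem_filter]
    rcases hvw with rfl | rfl
    · exact Or.inl ⟨hv, hw⟩
    · exact Or.inr (by simpa using ⟨hw, hv⟩)
  refine (Finset.card_le_card h).trans ((Finset.card_union_le _ _).trans ?_)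
  rw [Finset.card_map]
  omega

/-- If every gap of `C` has two vertices, both in `U`, then the vertices of the cycle are
`d, σ d, σ (σ d)` with `d ∈ C` and the latter two in `U`. -/
lemma gap_of_card_eq (hC : IsMaximalIndependentCyclic σ C) {U : Finset V} (hU : Disjoint U C)
    (h1 : (gapPairs σ C).card ≤ (U.filter fun p => σ p ∈ U).card)
    (h2 : C.card ≤ (gapPairs σ C).card) :
    ∀ d ∈ C, σ d ∈ U ∧ σ (σ d) ∈ U ∧ σ (σ (σ d)) ∈ C := by
  have e1 := Finset.eq_of_subset_of_card_le (matching_subset_gapPairs (σ := σ) hU) h1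
  have e2 := Finset.eq_of_subset_of_card_le hC.map_symm_gapPairs_subset (by rwa [Finset.card_map])
  intro d hd
  rw [← e2, Finset.mem_map_equiv, Equiv.symm_symm] at hd
  have hd' := hd
  rw [← e1, Finset.mem_filter] at hd
  refine ⟨hd.1, hd.2, ?_⟩
  refine (hC.mem_or_mem _ (Finset.disjoint_left.mp hU hd.2)).resolve_right fun h => ?_
  rw [Equiv.symm_apply_apply] at h
  exact (mem_gapPairs.mp hd').1 h

end IsMaximalIndependentCyclic

variable {k : Type*} [Field k]

/-- The vertices of `C` in `W` are folded away one by one, until `⊤` is isolated. The missing `d₀`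
is what starts this. -/
lemma suspension_isGraphAcyclicAt_of_gap
    (hadj : ∀ u v, G.Adj u v ↔ v = σ u ∨ u = σ v) (htrans : ∀ u v, ∃ m : ℕ, (σ ^ m) u = v)
    (hsucc : ∀ d ∈ C, σ d ∉ C) (hthree : ∀ d ∈ C, σ (σ (σ d)) ∈ C) {d₀ : V}
    (W : Finset (WithTop V)) (htop : ⊤ ∈ W) (hd₀ : (d₀ : WithTop V) ∉ W) (hd₀C : d₀ ∈ C)
    (hgap : ∀ d ∈ C, d ≠ d₀ → ((σ (σ d) : V) : WithTop V) ∈ W) (s : ℕ) :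
    IsGraphAcyclicAt k (suspension G C) W s := by
  induction hc : W.card using Nat.strong_induction_on generalizing W with
  | _ N ih =>
    have hsucc' : ∀ d ∈ C, σ (σ d) ∉ C := fun d hd h => hsucc _ h (hthree d hd)
    by_cases hW : ∃ d ∈ C, (d : WithTop V) ∈ W
    swap
    · push Not at hW
      refine IsGraphAcyclicAt.of_isolated htop fun x hx h => ?_
      induction x using WithTop.recTopCoe with
      | top => exact h.ne rfl
      | coe v => exact hW v (suspension_adj_top_coe.mp h) hx
    -- Otherwise walking in steps of three from a vertex of `C` never leaves `W`, yet it must meet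
    -- `d₀`.
    obtain ⟨d, hd, hdW, hd3⟩ : ∃ d ∈ C, (d : WithTop V) ∈ W ∧
        ((σ (σ (σ d)) : V) : WithTop V) ∉ W := by
      by_contra! hcon
      obtain ⟨d, hd, hdW⟩ := hW
      obtain ⟨m, hm⟩ := htrans d d₀
      have hiter : ∀ q : ℕ, (σ ^ (3 * q)) d ∈ C ∧ (((σ ^ (3 * q)) d : V) : WithTop V) ∈ W := by
        intro q
        induction q with
        | zero => exact ⟨hd, hdW⟩
        | succ q ihq =>
          have e : (σ ^ (3 * (q + 1))) d = σ (σ (σ ((σ ^ (3 * q)) d))) := by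
            rw [show 3 * (q + 1) = 3 * q + 1 + 1 + 1 by ring, pow_succ', pow_succ', pow_succ']
            rfl
          rw [e]
          exact ⟨hthree _ ihq.1, hcon _ ihq.1 ihq.2⟩
      have hq := hiter (m / 3)
      have hm3 : m % 3 = 0 ∨ m % 3 = 1 ∨ m % 3 = 2 := by omega
      rcases hm3 with h | h | h
      · rw [show 3 * (m / 3) = m by omega, hm] at hq
        exact hd₀ hq.2
      · have e : (σ ^ m) d = σ ((σ ^ (3 * (m / 3))) d) := by
          conv_lhs => rw [show m = 3 * (m / 3) + 1 by omega, pow_succ']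
          rfl
        rw [hm] at e
        exact hsucc _ hq.1 (e ▸ hd₀C)
      · have e : (σ ^ m) d = σ (σ ((σ ^ (3 * (m / 3))) d)) := by
          conv_lhs => rw [show m = 3 * (m / 3) + 1 + 1 by omega, pow_succ', pow_succ']
          rfl
        rw [hm] at e
        exact hsucc' _ hq.1 (e ▸ hd₀C)
    have hdd₀ : d ≠ d₀ := fun h => hd₀ (h ▸ hdW)
    have hne : ∀ e ∉ C, (e : WithTop V) ≠ d := fun e he h => he (WithTop.coe_injective h ▸ hd)
    refine IsGraphAcyclicAt.of_nonNeighbors_of_erase hdW (fun t _ => ?_) ?_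
    -- As `σ (σ (σ d))` is missing, the only possible neighbour of `σ (σ d)` in `W` is `σ d`, also a
    -- neighbour of `d`.
    · refine IsGraphAcyclicAt.nonNeighbors_of_dominated (u := ((σ (σ d) : V) : WithTop V))
        (hgap d hd hdd₀) (hne _ (hsucc' d hd)) ?_ ?_
      · rw [suspension_adj_coe_coe, hadj]
        rintro (h | h)
        · exact hsucc d hd (by rwa [σ.injective h])
        · exact hd3 (h ▸ hdW)
      · intro x hx h
        induction x using WithTop.recTopCoe with
        | top => exact absurd (suspension_adj_coe_top.mp h) (hsucc' d hd)
        | coe v =>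
          rw [suspension_adj_coe_coe, hadj] at h ⊢
          rcases h with rfl | h
          · exact absurd hx hd3
          · exact Or.inl (σ.injective h).symm
    · refine ih _ ?_ (W.erase d) (Finset.mem_erase.mpr ⟨WithTop.top_ne_coe, htop⟩)
        (fun h => hd₀ (Finset.mem_of_mem_erase h)) (fun e he he' => ?_) rfl
      · rw [← hc]; exact Finset.card_erase_lt_of_mem hdW
      · exact Finset.mem_erase.mpr ⟨hne _ (hsucc' e he), hgap e he he'⟩

/-- Deleting `σ d₀` keeps the class, since its link misses `d₀` and is acyclic. Then `σ (σ d₀)` can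
only be adjacent to `σ (σ (σ d₀))`, a neighbour of `⊤`, so `⊤` folds away too. -/
lemma exists_not_isGraphAcyclicAt_of_gap
    (hadj : ∀ u v, G.Adj u v ↔ v = σ u ∨ u = σ v) (htrans : ∀ u v, ∃ m : ℕ, (σ ^ m) u = v)
    (hsucc : ∀ d ∈ C, σ d ∉ C) {W : Finset (WithTop V)} (htop : ⊤ ∈ W)
    (hgap : ∀ d ∈ C, ((σ d : V) : WithTop V) ∈ W ∧ ((σ (σ d) : V) : WithTop V) ∈ W ∧
      σ (σ (σ d)) ∈ C)
    (hne : C.Nonempty) {s : ℕ} (hW : ¬ IsGraphAcyclicAt k (suspension G C) W s) :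
    ∃ U : Finset V, ¬ IsGraphAcyclicAt k G U s := by
  obtain ⟨d₀, hd₀⟩ := hne
  have hsucc' : ∀ d ∈ C, σ (σ d) ∉ C := fun d hd h => hsucc _ h (hgap d hd).2.2
  have hdel : ¬ IsGraphAcyclicAt k (suspension G C) (W.erase (σ d₀ : V)) s := by
    refine fun h => hW (IsGraphAcyclicAt.of_nonNeighbors_of_erase (hgap d₀ hd₀).1 (fun t _ => ?_) h)
    refine suspension_isGraphAcyclicAt_of_gap hadj htrans hsucc (fun d hd => (hgap d hd).2.2)
      (d₀ := d₀) _ ?_ ?_ hd₀ ?_ t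
    · refine mem_nonNeighbors.mpr ⟨htop, WithTop.top_ne_coe, fun h => ?_⟩
      exact hsucc d₀ hd₀ (suspension_adj_coe_top.mp h)
    · refine fun h => (mem_nonNeighbors.mp h).2.2 ?_
      rw [suspension_adj_coe_coe, hadj]
      exact Or.inr rfl
    · intro d hd hdd₀
      refine mem_nonNeighbors.mpr ⟨(hgap d hd).2.1, fun h => ?_, fun h => ?_⟩
      · have := σ.injective (WithTop.coe_injective h)
        exact hsucc d hd (this ▸ hd₀)
      · rw [suspension_adj_coe_coe, hadj] at h
        rcases h with h | h
        · exact hdd₀ (σ.injective (σ.injective h))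
        · exact hsucc d₀ hd₀ (h ▸ (hgap d hd).2.2)
  have htop' : ⊤ ∈ W.erase (σ d₀ : V) := Finset.mem_erase.mpr ⟨WithTop.top_ne_coe, htop⟩
  have hdel' : ¬ IsGraphAcyclicAt k (suspension G C) ((W.erase (σ d₀ : V)).erase ⊤) s := by
    refine fun h => hdel (IsGraphAcyclicAt.of_nonNeighbors_of_erase htop' (fun t _ => ?_) h)
    refine IsGraphAcyclicAt.nonNeighbors_of_dominated (u := ((σ (σ d₀) : V) : WithTop V))
      ?_ WithTop.coe_ne_top ?_ ?_
    · refine Finset.mem_erase.mpr ⟨fun h => ?_, (hgap d₀ hd₀).2.1⟩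
      exact hsucc d₀ hd₀ (by rwa [σ.injective (WithTop.coe_injective h)])
    · rw [suspension_adj_top_coe]
      exact hsucc' d₀ hd₀
    · intro x hx h
      induction x using WithTop.recTopCoe with
      | top => exact absurd (suspension_adj_coe_top.mp h) (hsucc' d₀ hd₀)
      | coe v =>
        rw [suspension_adj_coe_coe, hadj] at h
        rw [suspension_adj_top_coe]
        rcases h with rfl | h
        · exact (hgap d₀ hd₀).2.2
        · exact absurd (congrArg _ (σ.injective h).symm) (Finset.ne_of_mem_erase hx)
  obtain ⟨U, hU⟩ := exists_eq_map_coeOrderHom (Finset.notMem_erase ⊤ (W.erase (σ d₀ : V)))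
  refine ⟨U, ?_⟩
  rwa [← IsGraphAcyclicAt.suspension_map_iff (C := (C : Set V)), hU]

end Rotation

/-! ### Nonvanishing cohomology in the cycle graph -/

section CycleGraph

variable {k : Type*} [Field k] {n : ℕ}

lemma cycleGraph_adj_iff_val (hn : 3 ≤ n) (u v : Fin n) :
    (SimpleGraph.cycleGraph n).Adj u v ↔ u.val + 1 = v.val ∨ v.val + 1 = u.val ∨
      (u.val = 0 ∧ v.val + 1 = n) ∨ (v.val = 0 ∧ u.val + 1 = n) := by
  rw [SimpleGraph.cycleGraph_adj']
  have hu := u.isLt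
  have hv := v.isLt
  rcases lt_trichotomy u v with h | h | h
  · rw [Fin.coe_sub_iff_lt.mpr h, Fin.coe_sub_iff_le.mpr h.le]
    rw [Fin.lt_def] at h
    omega
  · subst h
    rw [Fin.coe_sub_iff_le.mpr le_rfl]
    omega
  · rw [Fin.coe_sub_iff_lt.mpr h, Fin.coe_sub_iff_le.mpr h.le]
    rw [Fin.lt_def] at h
    omega

lemma cycleGraph_adj_iff_finRotate (hn : 3 ≤ n) (u v : Fin n) :
    (SimpleGraph.cycleGraph n).Adj u v ↔ v = finRotate n u ∨ u = finRotate n v := by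
  obtain ⟨m, rfl⟩ : ∃ m, n = m + 1 := ⟨n - 1, by omega⟩
  rw [cycleGraph_adj_iff_val hn, Fin.ext_iff, Fin.ext_iff, coe_finRotate, coe_finRotate]
  have hu := u.isLt
  have hv := v.isLt
  simp only [Fin.ext_iff, Fin.val_last]
  split_ifs <;> omega

lemma exists_finRotate_pow_eq (hn : 3 ≤ n) (u v : Fin n) : ∃ m : ℕ, (finRotate n ^ m) u = v := by
  have hmem : ∀ w : Fin n, finRotate n w ≠ w := fun w => by
    rw [← Equiv.Perm.mem_support, support_finRotate_of_le (by omega)]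
    exact Finset.mem_univ _
  obtain ⟨m, -, hm⟩ := ((isCycle_finRotate_of_le (by omega)).sameCycle (hmem u) (hmem v)).exists_pow_eq'
  exact ⟨m, hm⟩

/-- The edges `{3 i, 3 i + 1}` with `i < m`, as a set of vertices. -/
def blockMatching (n m : ℕ) : Finset (Fin n) :=
  Finset.univ.filter fun v => v.val < 3 * m ∧ v.val % 3 ≠ 2

lemma mem_blockMatching {m : ℕ} {v : Fin n} :
    v ∈ blockMatching n m ↔ v.val < 3 * m ∧ v.val % 3 ≠ 2 := by
  simp [blockMatching]

/-- The bound `3 * m ≤ n` leaves an unused vertex after each edge, also around the end of the cycle,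
so the edges are pairwise non-adjacent and can be peeled off from the last. -/
lemma not_isGraphAcyclicAt_blockMatching (hn : 3 ≤ n) {m : ℕ} (hm : 3 * m ≤ n) :
    ¬ IsGraphAcyclicAt k (SimpleGraph.cycleGraph n) (blockMatching n m) m := by
  induction m with
  | zero =>
    have : blockMatching n 0 = ∅ := by
      ext v
      simp [mem_blockMatching]
    rw [this]
    exact IsGraphAcyclicAt.not_empty_zero
  | succ m ih =>
    intro h
    apply ih (by omega)
    let p : Fin n := ⟨3 * m, by omega⟩
    let q : Fin n := ⟨3 * m + 1, by omega⟩
    have hp : p ∈ blockMatching n (m + 1) := mem_blockMatching.mpr (by simp only [p]; omega)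
    have hq : q ∈ (blockMatching n (m + 1)).erase p := by
      rw [Finset.mem_erase, mem_blockMatching, Ne, Fin.ext_iff]
      simp only [p, q]
      omega
    have hL : nonNeighbors (SimpleGraph.cycleGraph n) (blockMatching n (m + 1)) p =
        blockMatching n m := by
      ext v
      have := v.isLt
      rw [mem_nonNeighbors, mem_blockMatching, mem_blockMatching, cycleGraph_adj_iff_val hn]
      simp only [ne_eq, Fin.ext_iff, p]
      omega
    rw [← hL]
    refine h.nonNeighbors hp (IsGraphAcyclicAt.of_isolated hq fun w hw => ?_)
    have := w.isLt
    rw [Finset.mem_erase, mem_blockMatching, Ne, Fin.ext_iff] at hw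
    rw [cycleGraph_adj_iff_val hn]
    simp only [p, q] at hw ⊢
    omega

/-- The path arises from the block matching by restoring the vertices `3 i + 2`, the largest first.
When restored, each dominates `3 i`, whose other neighbour is absent. -/
lemma not_isGraphAcyclicAt_path (hn : 3 ≤ n) {c : ℕ} (hc : n = 3 * c + 2) :
    ¬ IsGraphAcyclicAt k (SimpleGraph.cycleGraph n)
      (Finset.univ.filter fun v => v.val + 2 ≤ 3 * c) c := by
  have key : ∀ m ≤ c, ¬ IsGraphAcyclicAt k (SimpleGraph.cycleGraph n)
      (Finset.univ.filter fun v => v.val + 2 ≤ 3 * c ∧ ¬ (v.val % 3 = 2 ∧ v.val < 3 * (c - m))) c := by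
    intro m hm
    induction m with
    | zero =>
      convert not_isGraphAcyclicAt_blockMatching (k := k) hn (m := c) (by omega) using 2
      ext v
      rw [mem_blockMatching, Finset.mem_filter]
      simp only [Finset.mem_univ, true_and]
      omega
    | succ m ih =>
      set W : Finset (Fin n) := Finset.univ.filter fun v =>
        v.val + 2 ≤ 3 * c ∧ ¬ (v.val % 3 = 2 ∧ v.val < 3 * (c - (m + 1))) with hW
      have hmem : ∀ v : Fin n, v ∈ W ↔
          v.val + 2 ≤ 3 * c ∧ ¬ (v.val % 3 = 2 ∧ v.val < 3 * (c - (m + 1))) := fun v => by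
        simp [hW]
      by_cases hm0 : m = 0
      · subst hm0
        convert ih (by omega) using 2
        ext v
        rw [hmem, Finset.mem_filter]
        simp only [Finset.mem_univ, true_and]
        omega
      intro h
      apply ih (by omega)
      let x : Fin n := ⟨3 * (c - (m + 1)) + 2, by omega⟩
      let u : Fin n := ⟨3 * (c - (m + 1)), by omega⟩
      have hx : x ∈ W := by rw [hmem]; simp only [x]; omega
      have hu : u ∈ W := by rw [hmem]; simp only [u]; omega
      convert (IsGraphAcyclicAt.iff_erase_of_dominated hx hu ?_ ?_ ?_).mp h using 2
      · ext v
        rw [Finset.mem_erase, hmem, Finset.mem_filter, Ne, Fin.ext_iff]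
        simp only [Finset.mem_univ, true_and, x]
        omega
      · rw [Ne, Fin.ext_iff]; simp only [x, u]; omega
      · rw [cycleGraph_adj_iff_val hn]; simp only [x, u]; omega
      · intro w hw
        rw [hmem] at hw
        rw [cycleGraph_adj_iff_val hn, cycleGraph_adj_iff_val hn]
        simp only [x, u]
        omega
  convert key c le_rfl using 2
  ext v
  simp

/-- Without the vertices `3 i + 1` below `3 * c`, the vertex `3 * c - 1` is isolated. They are
restored from the largest down, each dominating the vertex two places before it on the cycle (`n -
1` when `i = 0`). -/
lemma isGraphAcyclicAt_erase (hn : 3 ≤ n) {c : ℕ} (hc : n = 3 * c + 2) (s : ℕ) :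
    IsGraphAcyclicAt k (SimpleGraph.cycleGraph n)
      (Finset.univ.filter fun v => v.val ≠ 3 * c) s := by
  have key : ∀ m ≤ c, IsGraphAcyclicAt k (SimpleGraph.cycleGraph n)
      (Finset.univ.filter fun v => v.val ≠ 3 * c ∧ ¬ (v.val % 3 = 1 ∧ v.val < 3 * (c - m))) s := by
    intro m hm
    induction m with
    | zero =>
      refine IsGraphAcyclicAt.of_isolated (v := (⟨3 * c - 1, by omega⟩ : Fin n)) ?_ ?_
      · simp only [Finset.mem_filter, Finset.mem_univ, true_and]
        omega
      · intro w
        simp only [Finset.mem_filter, Finset.mem_univ, true_and]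
        rw [cycleGraph_adj_iff_val hn]
        have := w.isLt
        simp only
        omega
    | succ m ih =>
      set W : Finset (Fin n) := Finset.univ.filter fun v =>
        v.val ≠ 3 * c ∧ ¬ (v.val % 3 = 1 ∧ v.val < 3 * (c - (m + 1))) with hW
      have hmem : ∀ v : Fin n, v ∈ W ↔
          v.val ≠ 3 * c ∧ ¬ (v.val % 3 = 1 ∧ v.val < 3 * (c - (m + 1))) := fun v => by
        simp [hW]
      let x : Fin n := ⟨3 * (c - (m + 1)) + 1, by omega⟩
      let u : Fin n := if h : c = m + 1 then ⟨n - 1, by omega⟩ else ⟨3 * (c - (m + 1)) - 1, by omega⟩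
      have hu' : (c = m + 1 ∧ u.val = n - 1) ∨ (c ≠ m + 1 ∧ u.val = 3 * (c - (m + 1)) - 1) := by
        by_cases h : c = m + 1
        · exact Or.inl ⟨h, by simp only [u, dif_pos h]⟩
        · exact Or.inr ⟨h, by simp only [u, dif_neg h]⟩
      have hx : x ∈ W := by rw [hmem]; simp only [x]; omega
      have hu : u ∈ W := by rw [hmem]; omega
      refine (IsGraphAcyclicAt.iff_erase_of_dominated hx hu ?_ ?_ ?_).mpr ?_
      · rw [Ne, Fin.ext_iff]; simp only [x]; omega
      · rw [cycleGraph_adj_iff_val hn]; simp only [x]; omega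
      · intro w hw
        have := w.isLt
        rw [hmem] at hw
        rw [cycleGraph_adj_iff_val hn, cycleGraph_adj_iff_val hn]
        simp only [x]
        omega
      · convert ih (by omega) using 2
        ext v
        rw [Finset.mem_erase, hmem, Finset.mem_filter, Ne, Fin.ext_iff]
        simp only [Finset.mem_univ, true_and, x]
        omega
  convert key c le_rfl using 2
  simp

/-- The link of the vertex `3 * c` is the non-acyclic path, and its deletion is the acyclic one. -/
lemma not_isGraphAcyclicAt_cycleGraph (hn : 3 ≤ n) {c : ℕ} (hc : n = 3 * c + 2) :
    ¬ IsGraphAcyclicAt k (SimpleGraph.cycleGraph n) Finset.univ (c + 1) := by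
  intro h
  apply not_isGraphAcyclicAt_path (k := k) hn hc
  have hL : nonNeighbors (SimpleGraph.cycleGraph n) Finset.univ (⟨3 * c, by omega⟩ : Fin n) =
      Finset.univ.filter fun v => v.val + 2 ≤ 3 * c := by
    ext v
    have := v.isLt
    rw [mem_nonNeighbors, cycleGraph_adj_iff_val hn, Finset.mem_filter, Ne, Fin.ext_iff]
    simp only [Finset.mem_univ, true_and]
    omega
  rw [← hL]
  refine h.nonNeighbors (Finset.mem_univ _) ?_
  convert isGraphAcyclicAt_erase (k := k) hn hc c using 2
  ext v
  rw [Finset.mem_erase, Finset.mem_filter, Ne, Fin.ext_iff]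
  simp

end CycleGraph

/-! ### Regularity and projective dimension as maxima over induced subgraphs -/

section GradedBetti

variable {k : Type*} [Field k] {V : Type*} [LinearOrder V] {G : SimpleGraph V}

lemma card_le_of_not_isGraphAcyclicAt {W : Finset V} {s : ℕ}
    (h : ¬ IsGraphAcyclicAt k G W s) : s ≤ W.card := by
  by_contra hlt
  exact h (IsGraphAcyclicAt.of_forall_card_ne fun F hF => by
    have := Finset.card_le_card hF
    omega)

variable [Fintype V]

lemma exists_gradedBetti_ne_zero_and_regularity_iff (m : ℤ) :
    (∃ i j : ℕ, gradedBetti (edgeIdeal k G) i j ≠ 0 ∧ m = (j : ℤ) - (i : ℤ)) ↔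
      ∃ (W : Finset V) (s : ℕ), ¬ IsGraphAcyclicAt k G W s ∧ m = s := by
  constructor
  · rintro ⟨i, j, h, rfl⟩
    obtain ⟨W, rfl, hij, hW⟩ := (gradedBetti_edgeIdeal_ne_zero_iff i j).mp h
    exact ⟨W, W.card - i, hW, by omega⟩
  · rintro ⟨W, s, hW, rfl⟩
    have hs := card_le_of_not_isGraphAcyclicAt hW
    refine ⟨W.card - s, W.card, (gradedBetti_edgeIdeal_ne_zero_iff _ _).mpr
      ⟨W, rfl, Nat.sub_le _ _, ?_⟩, by omega⟩
    rwa [Nat.sub_sub_self hs]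

lemma exists_gradedBetti_ne_zero_iff (i : ℕ) :
    (∃ j : ℕ, gradedBetti (edgeIdeal k G) i j ≠ 0) ↔
      ∃ (W : Finset V) (s : ℕ), ¬ IsGraphAcyclicAt k G W s ∧ W.card = i + s := by
  constructor
  · rintro ⟨j, h⟩
    obtain ⟨W, rfl, hij, hW⟩ := (gradedBetti_edgeIdeal_ne_zero_iff i j).mp h
    exact ⟨W, W.card - i, hW, by omega⟩
  · rintro ⟨W, s, hW, hc⟩
    refine ⟨W.card, (gradedBetti_edgeIdeal_ne_zero_iff _ _).mpr ⟨W, rfl, by omega, ?_⟩⟩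
    rwa [hc, Nat.add_sub_cancel_left]

lemma isRegularity_iff (r : ℕ) : IsRegularity (edgeIdeal k G) r ↔
    IsGreatest {s | ∃ W : Finset V, ¬ IsGraphAcyclicAt k G W s} r := by
  rw [IsRegularity, IsGreatest, IsGreatest, Set.mem_ofPred_eq, Set.mem_ofPred_eq,
    exists_gradedBetti_ne_zero_and_regularity_iff]
  refine and_congr ⟨?_, ?_⟩ ⟨?_, ?_⟩
  · rintro ⟨W, s, h, hr⟩
    exact ⟨W, by rwa [Nat.cast_injective hr]⟩
  · rintro ⟨W, h⟩
    exact ⟨W, r, h, rfl⟩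
  · rintro h s ⟨W, hW⟩
    exact_mod_cast h ((exists_gradedBetti_ne_zero_and_regularity_iff (s : ℤ)).mpr ⟨W, s, hW, rfl⟩)
  · intro h m hm
    obtain ⟨W, s, hW, rfl⟩ := (exists_gradedBetti_ne_zero_and_regularity_iff m).mp hm
    exact_mod_cast h ⟨W, hW⟩

lemma isProjDim_iff (p : ℕ) : IsProjDim (edgeIdeal k G) p ↔
    IsGreatest {i | ∃ (W : Finset V) (s : ℕ), ¬ IsGraphAcyclicAt k G W s ∧ W.card = i + s} p := by
  rw [IsProjDim]
  simp only [exists_gradedBetti_ne_zero_iff]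

lemma exists_isGreatest_nat {S : Set ℕ} (hne : S.Nonempty) (hb : BddAbove S) :
    ∃ m, IsGreatest S m :=
  ⟨sSup S, Nat.sSup_mem hne hb, fun _ h => le_csSup hb h⟩

variable (k G) in
lemma exists_isGreatest_regularity :
    ∃ r, IsGreatest {s | ∃ W : Finset V, ¬ IsGraphAcyclicAt k G W s} r := by
  refine exists_isGreatest_nat ⟨0, ∅, IsGraphAcyclicAt.not_empty_zero⟩ ⟨Fintype.card V, ?_⟩
  rintro s ⟨W, hW⟩
  exact (card_le_of_not_isGraphAcyclicAt hW).trans (Finset.card_le_univ W)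

variable (k G) in
lemma exists_isGreatest_projDim : ∃ p, IsGreatest
    {i | ∃ (W : Finset V) (s : ℕ), ¬ IsGraphAcyclicAt k G W s ∧ W.card = i + s} p := by
  refine exists_isGreatest_nat ⟨0, ∅, 0, IsGraphAcyclicAt.not_empty_zero, rfl⟩ ⟨Fintype.card V, ?_⟩
  rintro i ⟨W, s, -, hW⟩
  have := Finset.card_le_univ W
  omega

end GradedBetti

/-! ### Comparison of the cycle with its suspension -/

section Main

variable {k : Type*} [Field k] {n : ℕ} {C : Finset (Fin n)}

lemma isMaximalIndependentCyclic_of_maximal (hn : 3 ≤ n)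
    (hC : Maximal (fun s : Set (Fin n) => (SimpleGraph.cycleGraph n).IsIndepSet s) C) :
    IsMaximalIndependentCyclic (finRotate n) C := by
  have hadj := cycleGraph_adj_iff_finRotate hn
  refine ⟨fun d hd h => ?_, fun v hv => ?_⟩
  · have hadj' := (hadj d (finRotate n d)).mpr (Or.inl rfl)
    exact hC.1 hd h hadj'.ne hadj'
  · by_contra! hcon
    refine hv (hC.2 (y := ((insert v C : Finset (Fin n)) : Set (Fin n)))
      (isIndepSet_insert hC.1 fun w hw h => ?_) (by simp) (by simp))
    rcases (hadj v w).mp h with rfl | rfl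
    · exact hcon.1 hw
    · exact hcon.2 (by rwa [Equiv.symm_apply_apply])

/-- The part of the vertex set `W` of the suspension that is not adjacent to the new vertex. -/
lemma exists_map_eq_nonNeighbors_top (G : SimpleGraph (Fin n)) (W : Finset (WithTop (Fin n))) :
    ∃ U : Finset (Fin n), Disjoint U C ∧
      U.map WithTop.coeOrderHom.toEmbedding = nonNeighbors (suspension G C) W ⊤ := by
  obtain ⟨U, hU⟩ := exists_eq_map_coeOrderHom (W := nonNeighbors (suspension G C) W ⊤)
    fun h => (mem_nonNeighbors.mp h).2.1 rfl
  refine ⟨U, Finset.disjoint_left.mpr fun u hu huC => ?_, hU⟩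
  rw [← mem_map_coeOrderHom, hU] at hu
  exact (mem_nonNeighbors.mp hu).2.2 (suspension_adj_top_coe.mpr huC)

lemma card_le_card_map_of_nonNeighbors_top {G : SimpleGraph (Fin n)} {W U : Finset (Fin n)}
    {W' : Finset (WithTop (Fin n))}
    (hW : W.map WithTop.coeOrderHom.toEmbedding = W'.erase ⊤)
    (hU : U.map WithTop.coeOrderHom.toEmbedding = nonNeighbors (suspension G C) W' ⊤) :
    W.card ≤ U.card + C.card := by
  refine (Finset.card_le_card fun v hv => ?_).trans (Finset.card_union_le U C)
  rw [Finset.mem_union, ← mem_map_coeOrderHom, hU, mem_nonNeighbors, suspension_adj_top_coe]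
  rw [← mem_map_coeOrderHom, hW, Finset.mem_erase] at hv
  by_cases hvC : v ∈ C
  · exact Or.inr hvC
  · exact Or.inl ⟨hv.2, hv.1, hvC⟩

lemma card_of_not_isGraphAcyclicAt_of_disjoint (hn : 3 ≤ n)
    (hC : IsMaximalIndependentCyclic (finRotate n) C) {U : Finset (Fin n)} (hU : Disjoint U C)
    {c : ℕ} (h : ¬ IsGraphAcyclicAt k (SimpleGraph.cycleGraph n) U c) :
    U.card = 2 * c ∧ c ≤ (U.filter fun p => finRotate n p ∈ U).card ∧
      (U.filter fun p => finRotate n p ∈ U).card ≤ (IsMaximalIndependentCyclic.gapPairs (finRotate n) C).card := by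
  have hadj := cycleGraph_adj_iff_finRotate hn
  obtain ⟨hcard, hiso⟩ := IsGraphAcyclicAt.card_eq_of_not (hC.neighbor_unique hadj hU) h
  have := IsMaximalIndependentCyclic.card_matching_le hadj hiso
  exact ⟨hcard, by omega,
    Finset.card_le_card (IsMaximalIndependentCyclic.matching_subset_gapPairs hU)⟩

lemma exists_regularity_ge (hn : 3 ≤ n) (hC : IsMaximalIndependentCyclic (finRotate n) C)
    {W : Finset (WithTop (Fin n))} {s : ℕ}
    (hW : ¬ IsGraphAcyclicAt k (suspension (SimpleGraph.cycleGraph n) C) W s) :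
    ∃ (U : Finset (Fin n)) (t : ℕ), ¬ IsGraphAcyclicAt k (SimpleGraph.cycleGraph n) U t ∧ s ≤ t := by
  by_cases htop : ⊤ ∈ W
  swap
  · obtain ⟨U, rfl⟩ := exists_eq_map_coeOrderHom htop
    exact ⟨U, s, by rwa [IsGraphAcyclicAt.suspension_map_iff] at hW, le_rfl⟩
  by_cases hdel : IsGraphAcyclicAt k (suspension (SimpleGraph.cycleGraph n) C) (W.erase ⊤) s
  swap
  · obtain ⟨U, hU⟩ := exists_eq_map_coeOrderHom (Finset.notMem_erase ⊤ W)
    exact ⟨U, s, by rwa [← hU, IsGraphAcyclicAt.suspension_map_iff] at hdel, le_rfl⟩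
  obtain ⟨c, rfl, hL⟩ : ∃ c, s = c + 1 ∧ ¬ IsGraphAcyclicAt k
      (suspension (SimpleGraph.cycleGraph n) C)
      (nonNeighbors (suspension (SimpleGraph.cycleGraph n) C) W ⊤) c := by
    by_contra! hcon
    exact hW (IsGraphAcyclicAt.of_nonNeighbors_of_erase htop hcon hdel)
  obtain ⟨U, hUC, hU⟩ := exists_map_eq_nonNeighbors_top (C := C) (SimpleGraph.cycleGraph n) W
  rw [← hU, IsGraphAcyclicAt.suspension_map_iff] at hL
  obtain ⟨-, h1, h2⟩ := card_of_not_isGraphAcyclicAt_of_disjoint hn hC hUC hL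
  have h3 := hC.card_gapPairs_le
  have h4 := hC.card_compl
  rw [Finset.card_compl, Fintype.card_fin] at h4
  have h5 := Finset.card_le_univ C
  rw [Fintype.card_fin] at h5
  rcases lt_or_ge n (3 * (c + 1)) with hlt | hge
  swap
  · exact ⟨_, _, not_isGraphAcyclicAt_blockMatching hn hge, le_rfl⟩
  by_cases hn2 : n = 3 * c + 2
  · exact ⟨_, _, not_isGraphAcyclicAt_cycleGraph hn hn2, le_rfl⟩
  -- With `n = 2|C| + g` and `c ≤ g ≤ |C|`, the cases left force `|C| = g = c`.
  have hgap := hC.gap_of_card_eq hUC (by omega) (by omega)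
  have hmem : ∀ v ∈ U, (v : WithTop (Fin n)) ∈ W := fun v hv => by
    rw [← mem_map_coeOrderHom, hU] at hv
    exact (mem_nonNeighbors.mp hv).1
  obtain ⟨U', hU'⟩ := exists_not_isGraphAcyclicAt_of_gap (cycleGraph_adj_iff_finRotate hn)
    (exists_finRotate_pow_eq hn) hC.succ_notMem htop
    (fun d hd => ⟨hmem _ (hgap d hd).1, hmem _ (hgap d hd).2.1, (hgap d hd).2.2⟩)
    (Finset.card_pos.mp (by omega)) hW
  exact ⟨U', _, hU', le_rfl⟩

lemma exists_projDim_ge_card_compl (hn : 3 ≤ n)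
    (hC : IsMaximalIndependentCyclic (finRotate n) C)
    (hind : (SimpleGraph.cycleGraph n).IsIndepSet (C : Set (Fin n))) :
    ∃ (W : Finset (Fin n)) (s : ℕ), ¬ IsGraphAcyclicAt k (SimpleGraph.cycleGraph n) W s ∧
      Cᶜ.card + s ≤ W.card := by
  refine IsGraphAcyclicAt.exists_not_of_maximal_independent hind fun v hv => ?_
  have hadj := cycleGraph_adj_iff_finRotate hn
  rcases hC.mem_or_mem v hv with h | h
  · exact ⟨_, h, (hadj _ _).mpr (Or.inr rfl)⟩
  · exact ⟨_, h, (hadj _ _).mpr (Or.inl (Equiv.apply_symm_apply _ v).symm)⟩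

lemma exists_suspension_projDim_ge_card_compl (hn : 3 ≤ n)
    (hC : IsMaximalIndependentCyclic (finRotate n) C)
    (hind : (SimpleGraph.cycleGraph n).IsIndepSet (C : Set (Fin n))) :
    ∃ (W : Finset (WithTop (Fin n))) (s : ℕ),
      ¬ IsGraphAcyclicAt k (suspension (SimpleGraph.cycleGraph n) C) W s ∧
        Cᶜ.card + 1 + s ≤ W.card := by
  have hadj := cycleGraph_adj_iff_finRotate hn
  obtain ⟨W, s, hW, hcard⟩ := IsGraphAcyclicAt.exists_not_of_maximal_independent (k := k)
    (G := suspension (SimpleGraph.cycleGraph n) C)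
    (F := C.map WithTop.coeOrderHom.toEmbedding) (by
      rw [Finset.coe_map]
      rintro _ ⟨a, ha, rfl⟩ _ ⟨b, hb, rfl⟩ hab h
      exact hind ha hb (fun h' => hab (by rw [h'])) (suspension_adj_coe_coe.mp h)) (by
      intro x hx
      induction x using WithTop.recTopCoe with
      | top =>
        have hne : 0 < C.card := by
          have h1 := hC.card_gapPairs_le
          have h2 := hC.card_compl
          rw [Finset.card_compl, Fintype.card_fin] at h2
          omega
        obtain ⟨d, hd⟩ := Finset.card_pos.mp hne
        exact ⟨d, mem_map_coeOrderHom.mpr hd, suspension_adj_coe_top.mpr hd⟩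
      | coe v =>
        rw [mem_map_coeOrderHom] at hx
        rcases hC.mem_or_mem v hx with h | h
        · exact ⟨_, mem_map_coeOrderHom.mpr h,
            suspension_adj_coe_coe.mpr ((hadj _ _).mpr (Or.inr rfl))⟩
        · exact ⟨_, mem_map_coeOrderHom.mpr h,
            suspension_adj_coe_coe.mpr ((hadj _ _).mpr (Or.inl (Equiv.apply_symm_apply _ v).symm))⟩)
  refine ⟨W, s, hW, le_trans (Nat.add_le_add_right (le_of_eq ?_) s) hcard⟩
  have h5 := Finset.card_le_univ C
  rw [Fintype.card_fin] at h5
  have hcardT : Fintype.card (WithTop (Fin n)) = n + 1 := by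
    rw [show Fintype.card (WithTop (Fin n)) = Fintype.card (Option (Fin n)) from
      Fintype.card_congr (Equiv.refl _), Fintype.card_option, Fintype.card_fin]
  rw [Finset.card_compl, Finset.card_compl, Finset.card_map, Fintype.card_fin, hcardT]
  omega

/-- If only the link of `⊤` carries a class, then `s = c + 1` and `|W| ≤ 2c + |C| + 1`, so `|W| - s
≤ c + |C| ≤ |Cᶜ|`, which the cycle attains. -/
lemma exists_projDim_ge_of_suspension (hn : 3 ≤ n)
    (hC : IsMaximalIndependentCyclic (finRotate n) C)
    (hind : (SimpleGraph.cycleGraph n).IsIndepSet (C : Set (Fin n)))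
    {W : Finset (WithTop (Fin n))} {s : ℕ}
    (hW : ¬ IsGraphAcyclicAt k (suspension (SimpleGraph.cycleGraph n) C) W s) :
    ∃ (U : Finset (Fin n)) (t : ℕ), ¬ IsGraphAcyclicAt k (SimpleGraph.cycleGraph n) U t ∧
      W.card + t ≤ U.card + s + 1 := by
  by_cases htop : ⊤ ∈ W
  swap
  · obtain ⟨U, rfl⟩ := exists_eq_map_coeOrderHom htop
    exact ⟨U, s, by rwa [IsGraphAcyclicAt.suspension_map_iff] at hW, by
      rw [Finset.card_map]; omega⟩
  obtain ⟨U, hU⟩ := exists_eq_map_coeOrderHom (Finset.notMem_erase ⊤ W)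
  have hUcard := congrArg Finset.card hU
  rw [Finset.card_map] at hUcard
  have hWcard := Finset.card_erase_add_one htop
  by_cases hdel : IsGraphAcyclicAt k (suspension (SimpleGraph.cycleGraph n) C) (W.erase ⊤) s
  swap
  · exact ⟨U, s, by rwa [← hU, IsGraphAcyclicAt.suspension_map_iff] at hdel, by omega⟩
  obtain ⟨c, rfl, hL⟩ : ∃ c, s = c + 1 ∧ ¬ IsGraphAcyclicAt k
      (suspension (SimpleGraph.cycleGraph n) C)
      (nonNeighbors (suspension (SimpleGraph.cycleGraph n) C) W ⊤) c := by
    by_contra! hcon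
    exact hW (IsGraphAcyclicAt.of_nonNeighbors_of_erase htop hcon hdel)
  obtain ⟨L, hLC, hLmap⟩ := exists_map_eq_nonNeighbors_top (C := C) (SimpleGraph.cycleGraph n) W
  rw [← hLmap, IsGraphAcyclicAt.suspension_map_iff] at hL
  obtain ⟨h0, h1, h2⟩ := card_of_not_isGraphAcyclicAt_of_disjoint hn hC hLC hL
  have h3 := card_le_card_map_of_nonNeighbors_top hU hLmap
  have h4 := hC.card_compl
  obtain ⟨U', t, hU', hcard⟩ := exists_projDim_ge_card_compl (k := k) hn hC hind
  exact ⟨U', t, hU', by omega⟩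

/-- If adjoining `⊤` to `U` kills the class, the link of `⊤` is a matching with `s` edges, so `|U| -
s ≤ s + |C| ≤ |Cᶜ|`, and the bound `|Cᶜ| + 1` for the suspension suffices. -/
lemma exists_suspension_projDim_ge (hn : 3 ≤ n)
    (hC : IsMaximalIndependentCyclic (finRotate n) C)
    (hind : (SimpleGraph.cycleGraph n).IsIndepSet (C : Set (Fin n)))
    {U : Finset (Fin n)} {s : ℕ} (hU : ¬ IsGraphAcyclicAt k (SimpleGraph.cycleGraph n) U s) :
    ∃ (W : Finset (WithTop (Fin n))) (t : ℕ),
      ¬ IsGraphAcyclicAt k (suspension (SimpleGraph.cycleGraph n) C) W t ∧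
        U.card + t + 1 ≤ W.card + s := by
  have htop := top_notMem_map_coeOrderHom (W := U)
  set W := insert ⊤ (U.map WithTop.coeOrderHom.toEmbedding) with hWdef
  have hWcard : W.card = U.card + 1 := by
    rw [hWdef, Finset.card_insert_of_notMem htop, Finset.card_map]
  have hWU : U.map WithTop.coeOrderHom.toEmbedding = W.erase ⊤ := by
    rw [hWdef, Finset.erase_insert htop]
  by_cases hW : IsGraphAcyclicAt k (suspension (SimpleGraph.cycleGraph n) C) W s
  swap
  · exact ⟨W, s, hW, by omega⟩
  obtain ⟨L, hLC, hLmap⟩ := exists_map_eq_nonNeighbors_top (C := C) (SimpleGraph.cycleGraph n) W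
  have hL : ¬ IsGraphAcyclicAt k (SimpleGraph.cycleGraph n) L s := fun hL => by
    rw [← IsGraphAcyclicAt.suspension_map_iff (C := (C : Set (Fin n))), hLmap] at hL
    have := hW.erase (Finset.mem_insert_self _ _) hL
    rw [← hWU, IsGraphAcyclicAt.suspension_map_iff] at this
    exact hU this
  obtain ⟨h0, h1, h2⟩ := card_of_not_isGraphAcyclicAt_of_disjoint hn hC hLC hL
  have h3 := card_le_card_map_of_nonNeighbors_top hWU hLmap
  have h4 := hC.card_compl
  obtain ⟨W', t, hW', hcard⟩ := exists_suspension_projDim_ge_card_compl (k := k) hn hC hind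
  exact ⟨W', t, hW', by omega⟩

end Main

theorem theorem4p6 (k : Type*) [Field k] (n : ℕ) (hn : 3 ≤ n) (C : Set (Fin n))
    (hC : Maximal (fun s : Set (Fin n) => (SimpleGraph.cycleGraph n).IsIndepSet s) C) :
    (∃ r : ℤ,
      IsRegularity (edgeIdeal k (SimpleGraph.cycleGraph n)) r ∧
      IsRegularity (edgeIdeal k (suspension (SimpleGraph.cycleGraph n) C)) r) ∧
    (∃ p : ℕ,
      IsProjDim (edgeIdeal k (SimpleGraph.cycleGraph n)) p ∧
      IsProjDim (edgeIdeal k (suspension (SimpleGraph.cycleGraph n) C)) (p + 1)) := by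
  obtain ⟨C, rfl⟩ := C.toFinite.exists_finset_coe
  have hcyc := isMaximalIndependentCyclic_of_maximal hn hC
  constructor
  · obtain ⟨r, hr⟩ := exists_isGreatest_regularity k (SimpleGraph.cycleGraph n)
    refine ⟨r, (isRegularity_iff r).mpr hr, (isRegularity_iff r).mpr ⟨?_, ?_⟩⟩
    · obtain ⟨W, hW⟩ := hr.1
      exact ⟨_, by rwa [IsGraphAcyclicAt.suspension_map_iff]⟩
    · rintro s ⟨W, hW⟩
      obtain ⟨U, t, hU, hst⟩ := exists_regularity_ge hn hcyc hW
      exact hst.trans (hr.2 ⟨U, hU⟩)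
  · obtain ⟨p, hp⟩ := exists_isGreatest_projDim k (SimpleGraph.cycleGraph n)
    obtain ⟨q, hq⟩ := exists_isGreatest_projDim k (suspension (SimpleGraph.cycleGraph n) C)
    refine ⟨p, (isProjDim_iff p).mpr hp, (isProjDim_iff (p + 1)).mpr ?_⟩
    have hqp : q = p + 1 := by
      apply le_antisymm
      · obtain ⟨W, s, hW, hc⟩ := hq.1
        obtain ⟨U, t, hU, hUc⟩ := exists_projDim_ge_of_suspension hn hcyc hC.1 hW
        have ht := card_le_of_not_isGraphAcyclicAt hU
        have := hp.2 ⟨U, t, hU, (Nat.sub_add_cancel ht).symm⟩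
        omega
      · obtain ⟨U, s, hU, hc⟩ := hp.1
        obtain ⟨W, t, hW, hWc⟩ := exists_suspension_projDim_ge hn hcyc hC.1 hU
        have ht := card_le_of_not_isGraphAcyclicAt hW
        have := hq.2 ⟨W, t, hW, (Nat.sub_add_cancel ht).symm⟩
        omega
    rw [← hqp]
    exact hq
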